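/- **Setting.** Let $d\ge 1$. Let $\mathbf X'=(X'_1,\dots,X'_d)$ have independent coordinates, where $X'_k$ has CDF $G_k$ and density $g_k$ concentrated on an open interval $\Omega'_k$, with $g_k\ge\rho_{\min}>0$ on $\Omega'_k$. Let the evaluation point $\mathbf X$ have independent coordinates with densities concentrated on open sets $\Omega_k\subseteq\Omega'_k$. Let $\mathbf V=(V_1,\dots,V_d)$ have independent coordinates uniform on $(-\xi,\xi)$, $\xi>0$, and put $\sigma^2=E[V_k^2]$. *Regularity.* Let $\mathfrak M:\mathbb R^d\to\mathbb R$ satisfy $E[\mathfrak M(\mathbf X)^2]<\infty$ and, for every non-empty $v\subseteq\{1,\dots,d\}$, have a weak cross-partial derivative $\prod_{k\in v}\partial_{x_k}\mathfrak M$ on $\prod_k\Omega_k$ that is square integrable for the law of $\mathbf X$. Suppose that for every $\alpha\in\{0,\dots,d+1\}$ there is a constant $M_\alpha>0$ with $$\Big|\mathfrak M(x)-\sum_{|\imath|\le\alpha-1}\frac{D^{(\imath)}\mathfrak M(y)}{\imath!}(x-y)^{\imath}\Big|\le M_\alpha\|x-y\|^{\alpha}\qquad(x,y\in\mathbb R^d),$$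 where $\imath$ runs over multi-indices, the $D^{(\imath)}\mathfrak M$ are weak partial derivatives on $\mathbb R^d$, and $\|\cdot\|$ is the Euclidean norm (for $\alpha=0$ this says $|\mathfrak M|\le M_0$). *Coefficients.* Let $r^*=d-1$, $L=d+1$, let $\beta_1,\dots,\beta_L$ be distinct reals, and let $C^{(p)}_1,\dots,C^{(p)}_L$ ($1\le p\le d$) be reals such that $\sum_{\ell=1}^{L}C^{(p)}_\ell\beta_\ell^r=\delta_{p,r}$ for $r=0,\dots,r^*$ and, in addition, for $r=p+2\lfloor (r^*-p)/2\rfloor+2$ if $p\le r^*$, and for $r=p$ if $p=d$. *Emulator.* Given two independent i.i.d. samples $\mathbf X'_1,\dots,\mathbf X'_N$ of $\mathbf X'$ and $\mathbf V_1,\dots,\mathbf V_N$ of $\mathbf V$, and $\mathsf h>0$, let $$\widehat{\mathfrak M^c_N}(x)=\frac1N\sum_{i=1}^N\sum_{\ell=1}^{L}\sum_{p=1}^d C^{(p)}_\ell\,\mathfrak M(\mathbf X'_i+\beta_\ell \mathsf h\mathbf V_i)\sum_{|w|=p}\prod_{k\in w}\frac{G_k(X'_{i,k})-\mathbf 1[X'_{i,k}\ge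 x_k]}{g_k(X'_{i,k})\,\mathsf h\,\sigma^2}V_{i,k},\qquad \mathfrak M^c(x)=\mathfrak M(x)-E[\mathfrak M(\mathbf X')],$$ where $w$ runs over the subsets of $\{1,\dots,d\}$ of cardinality $p$. The MSE at $x$ is $E[(\widehat{\mathfrak M^c_N}(x)-\mathfrak M^c(x))^2]$; the IMSE is its average over $x$ distributed as $\mathbf X$. Put $$\Gamma^{(p)}_r=\sum_{\ell}|C^{(p)}_\ell\beta_\ell^r|,\qquad \digamma_d^{\max}=\max_{1\le p\le d}M_p\,\Gamma^{(p)}_p .$$ **Statement.** Suppose $\mathsf h=cN^{-\eta}$ with $c>0$ and $\eta\in\,]1/2,1[$, and $\xi\le\big[d\,M_{d+1}\,\Gamma^{(d)}_{d+1}\,(2\rho_{\min})^{-d}\big]^{-1}$. Then the MSE at every $x\in\prod_k\Omega'_k$, and the IMSE, are for every $N\ge1$ at most $$\frac{(\digamma_d^{\max})^2}{N}\left[\Big(\frac{d+0.8}{3\rho_{\min}^2}+1\Big)^d-1\right]+O(N^{-1}).$$ (i) If $\rho_{\min}=\sqrt{(d+0.8)/3}$, they are at most $\frac{(\digamma_d^{\max})^2}{N}(2^d-1)+O(N^{-1})$.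 (ii) If $\rho_{\min}=\sqrt{c_0d(d+0.8)/3}$ with $1\le c_0\le2$, they are at most $$\frac{(\digamma_d^{\max})^2}{N}\min\Big\{\frac1{c_0-1},\Big(\frac1{c_0d}+1\Big)^d-1\Big\}+O(N^{-1}),$$ where $1/(c_0-1)$ is read as $+\infty$ for $c_0=1$. In all cases the remainder is at most $K/N$ with a constant $K\ge 0$ that may depend on $d$, the $\beta_\ell$ and $C^{(p)}_\ell$, the $M_\alpha$, $\rho_{\min}$ and $c$, but not on $N$, $x$, $\eta$, $\xi$, $\mathfrak M$ or the distributions of $\mathbf X$ and $\mathbf X'$. Moreover, for each fixed $d\ge1$, $\big(\frac1{c_0d}+1\big)^d-1\sim\frac1{c_0}$ as $c_0\to\infty$. -/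

import Mathlib

open MeasureTheory ProbabilityTheory

noncomputable section

namespace Emulator

/-! ### Function spaces -/

/-- Euclidean norm of a vector of coordinates. -/
def enorm2 {d : ℕ} (x : Fin d → ℝ) : ℝ := ‖WithLp.toLp 2 x‖

/-- Partial derivative in the `k`-th coordinate. -/
def partialDeriv {d : ℕ} (k : Fin d) (φ : (Fin d → ℝ) → ℝ) : (Fin d → ℝ) → ℝ :=
  fun x => fderiv ℝ φ x (Pi.single k 1)

/-- The iterated partial derivative with multi-index `i`. -/
def multiDeriv {d : ℕ} (i : Fin d → ℕ) (φ : (Fin d → ℝ) → ℝ) : (Fin d → ℝ) → ℝ :=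
  (List.finRange d).foldr (fun k ψ => (partialDeriv k)^[i k] ψ) φ

/-- `D` is a weak partial derivative of `M`, with multi-index `i`, on the open set `U`. -/
def IsWeakDeriv {d : ℕ} (U : Set (Fin d → ℝ)) (i : Fin d → ℕ) (M D : (Fin d → ℝ) → ℝ) : Prop :=
  LocallyIntegrableOn M U ∧ LocallyIntegrableOn D U ∧
    ∀ φ : (Fin d → ℝ) → ℝ, ContDiff ℝ (⊤ : ℕ∞) φ → HasCompactSupport φ → tsupport φ ⊆ U →
      ∫ x in U, M x * multiDeriv i φ x = (-1) ^ (∑ k, i k) * ∫ x in U, D x * φ x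

/-- `M` belongs to the Hölder space of order `α` with constant `A`: for all `x, y`, the Taylor
polynomial of degree `α - 1` at `y`, built from (weak) partial derivatives, approximates `M x`
up to `A ‖x - y‖ ^ α`. For `α = 0` the polynomial is zero, and `M` is bounded by `A`. -/
def InHolder {d : ℕ} (α : ℕ) (A : ℝ) (M : (Fin d → ℝ) → ℝ) : Prop :=
  ∃ D : (Fin d → ℕ) → (Fin d → ℝ) → ℝ,
    (∀ i, ∑ k, i k < α → IsWeakDeriv Set.univ i M (D i)) ∧
    ∀ x y : Fin d → ℝ,
      |M x - ∑ r ∈ Finset.range α, ∑ i ∈ Finset.piAntidiag (Finset.univ : Finset (Fin d)) r,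
          D i y / (∏ k, ((i k).factorial : ℝ)) * ∏ k, (x k - y k) ^ i k|
        ≤ A * enorm2 (x - y) ^ α

/-- The Hilbert-Sobolev space on `U` with respect to the law `μ`: `M` and all its weak
cross-partial derivatives (at most once in each coordinate) are square integrable. -/
def InSobolev {d : ℕ} (U : Set (Fin d → ℝ)) (μ : Measure (Fin d → ℝ))
    (M : (Fin d → ℝ) → ℝ) : Prop :=
  MemLp M 2 μ ∧ ∀ v : Finset (Fin d), v.Nonempty →
    ∃ D, IsWeakDeriv U (fun k => if k ∈ v then 1 else 0) M D ∧ MemLp D 2 μ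

/-! ### Laws of the inputs -/

/-- `f` is a probability density that vanishes outside `I`. -/
structure IsDensityOn (f : ℝ → ℝ) (I : Set ℝ) : Prop where
  measurable : Measurable f
  nonneg : ∀ t, 0 ≤ f t
  zero_outside : ∀ t, t ∉ I → f t = 0
  lintegral_eq_one : ∫⁻ t, ENNReal.ofReal (f t) = 1

/-- The law on the line with density `f`. -/
def densityLaw (f : ℝ → ℝ) : Measure ℝ := volume.withDensity fun t => ENNReal.ofReal (f t)

/-- The law of a vector of independent variables with marginal densities `f k`. -/
def productLaw {d : ℕ} (f : Fin d → ℝ → ℝ) : Measure (Fin d → ℝ) :=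
  Measure.pi fun k => densityLaw (f k)

/-- `σ² = E[V²]` for `V` uniform on `(-ξ, ξ)`. -/
def sigmaSq (ξ : ℝ) : ℝ :=
  ∫ v, v ^ 2 ∂(ProbabilityTheory.cond (volume : Measure ℝ) (Set.Ioo (-ξ) ξ))

/-- Two independent samples of size `N`: the `X i` from the vector with independent coordinates
of densities `g k`, the `V i` from the vector with independent coordinates uniform on
`(-ξ, ξ)`. -/
structure IsSample {S : Type*} [MeasurableSpace S] (P : Measure S) {d N : ℕ}
    (g : Fin d → ℝ → ℝ) (ξ : ℝ) (X V : Fin N → Fin d → S → ℝ) : Prop where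
  measurable_X : ∀ i k, Measurable (X i k)
  measurable_V : ∀ i k, Measurable (V i k)
  law_X : ∀ i k, P.map (X i k) = densityLaw (g k)
  law_V : ∀ i k, pdf.IsUniform (V i k) (Set.Ioo (-ξ) ξ) P volume
  indep : iIndepFun (Sum.elim (fun a : Fin N × Fin d => X a.1 a.2)
    (fun a : Fin N × Fin d => V a.1 a.2)) P

/-! ### The emulator -/

/-- The elementary symmetric polynomial of degree `p` in `r 0, …, r (d - 1)`. -/
def esp {d : ℕ} (p : ℕ) (r : Fin d → ℝ) : ℝ :=
  ∑ w ∈ Finset.powersetCard p (Finset.univ : Finset (Fin d)), ∏ k ∈ w, r k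

open Classical in
/-- `R_k(x_k, x'_k, v_k) = (G_k(x'_k) - 1[x'_k ≥ x_k]) v_k / (g_k(x'_k) h_k σ²)`. -/
def weightR {d : ℕ} (g : Fin d → ℝ → ℝ) (h : Fin d → ℝ) (s2 : ℝ) (x x' v : Fin d → ℝ)
    (k : Fin d) : ℝ :=
  (cdf (densityLaw (g k)) (x' k) - (if x k ≤ x' k then 1 else 0)) / (g k (x' k) * h k * s2) * v k

/-- The full emulator at `x`, computed from the samples `X`, `V`. -/
def emulator {d N L : ℕ} (M : (Fin d → ℝ) → ℝ) (g : Fin d → ℝ → ℝ) (h : Fin d → ℝ) (s2 : ℝ)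
    (β : Fin L → ℝ) (C : ℕ → Fin L → ℝ) (X V : Fin N → Fin d → ℝ) (x : Fin d → ℝ) : ℝ :=
  1 / (N : ℝ) * ∑ i, ∑ l, ∑ p ∈ Finset.Icc 1 d,
    C p l * M (fun k => X i k + β l * h k * V i k) * esp p (weightR g h s2 x (X i) (V i))

/-- The centered output `M(x) - E[M(X')]`. -/
def centered {d : ℕ} (M : (Fin d → ℝ) → ℝ) (g : Fin d → ℝ → ℝ) (x : Fin d → ℝ) : ℝ :=
  M x - ∫ x', M x' ∂(productLaw g)

/-- Mean squared error at `x`, for `V` uniform on `(-ξ, ξ)`. -/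
def mse {S : Type*} [MeasurableSpace S] (P : Measure S) {d N L : ℕ} (M : (Fin d → ℝ) → ℝ)
    (g : Fin d → ℝ → ℝ) (h : Fin d → ℝ) (ξ : ℝ) (β : Fin L → ℝ) (C : ℕ → Fin L → ℝ)
    (X V : Fin N → Fin d → S → ℝ) (x : Fin d → ℝ) : ENNReal :=
  ∫⁻ ω, ENNReal.ofReal
    ((emulator M g h (sigmaSq ξ) β C (fun i k => X i k ω) (fun i k => V i k ω) x
      - centered M g x) ^ 2) ∂P

/-- Integrated mean squared error, for evaluation points with marginal densities `f k`. -/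
def imse {S : Type*} [MeasurableSpace S] (P : Measure S) {d N L : ℕ} (M : (Fin d → ℝ) → ℝ)
    (f g : Fin d → ℝ → ℝ) (h : Fin d → ℝ) (ξ : ℝ) (β : Fin L → ℝ) (C : ℕ → Fin L → ℝ)
    (X V : Fin N → Fin d → S → ℝ) : ENNReal :=
  ∫⁻ x, mse P M g h ξ β C X V x ∂(productLaw f)

/-- Both the mean squared error at every point of the product of the `I k` and the integrated
mean squared error are at most `T`. -/
def ErrorsBoundedBy {S : Type*} [MeasurableSpace S] (P : Measure S) {d N L : ℕ}
    (I : Fin d → Set ℝ) (M : (Fin d → ℝ) → ℝ) (f g : Fin d → ℝ → ℝ) (h : Fin d → ℝ) (ξ : ℝ)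
    (β : Fin L → ℝ) (C : ℕ → Fin L → ℝ) (X V : Fin N → Fin d → S → ℝ) (T : ℝ) : Prop :=
  (∀ x ∈ Set.univ.pi I, mse P M g h ξ β C X V x ≤ ENNReal.ofReal T) ∧
    imse P M f g h ξ β C X V ≤ ENNReal.ofReal T

/-- The linear constraints on the coefficients `C p l`, `p = 1, …, d`, for the parameter `rs`
(`rs + 2 ≤ L`): `∑ l, C p l * β l ^ r = δ_{p,r}` for the listed exponents `r`. For `p ≤ rs`
these are `0, …, rs` and `p + 2 λ + 2 j`, `j = 1, …, L - 1 - rs`, `λ = ⌊(rs - p) / 2⌋`; for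
`p > rs` they are `0, …, rs` and `p, p + 2, …, p + 2 (L - rs - 2)`. -/
def CoeffConstraints (d rs : ℕ) {L : ℕ} (β : Fin L → ℝ) (C : ℕ → Fin L → ℝ) : Prop :=
  ∀ p ∈ Finset.Icc 1 d, ∀ r : ℕ,
    (r ≤ rs ∨
      (p ≤ rs ∧ ∃ j : ℕ, 1 ≤ j ∧ j ≤ L - 1 - rs ∧ r = p + 2 * ((rs - p) / 2) + 2 * j) ∨
      (rs < p ∧ ∃ j : ℕ, j ≤ L - rs - 2 ∧ r = p + 2 * j)) →
    ∑ l, C p l * β l ^ r = if p = r then 1 else 0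

/-- `Γ_r = ∑ l, |C p l * β l ^ r|`, for subsets `w` of cardinality `p`. -/
def Gam {L : ℕ} (β : Fin L → ℝ) (C : ℕ → Fin L → ℝ) (p r : ℕ) : ℝ :=
  ∑ l, |C p l * β l ^ r|

/-- The maximum of `M_{|w|} Γ_{|w|}` over the non-empty subsets `w` of the `d` inputs. -/
def digammaMax (d : ℕ) (hd : 1 ≤ d) {L : ℕ} (A : ℕ → ℝ) (β : Fin L → ℝ)
    (C : ℕ → Fin L → ℝ) : ℝ :=
  (Finset.Icc 1 d).sup' (Finset.nonempty_Icc.mpr hd) fun p => A p * Gam β C p p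

/-- `min {1 / (c₀ - 1), (1 / (c₀ d) + 1) ^ d - 1}`, where `1 / (c₀ - 1)` is `+∞` for `c₀ = 1`. -/
def minFactor (d : ℕ) (c₀ : ℝ) : ℝ :=
  open Classical in
  if c₀ = 1 then (1 / (c₀ * d) + 1) ^ d - 1
  else min (1 / (c₀ - 1)) ((1 / (c₀ * d) + 1) ^ d - 1)

end Emulator

end

namespace Emulator

/-! The error at a point splits into variance and squared bias, and both are at most a constant over
`N`. Their sum already fits into the remainder `K / N`. The explicit leading terms therefore enter
only through their nonnegativity, and all three bounds follow from one estimate.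

Variance. The emulator is an average of `N` pairwise independent copies of `summand`. The
coefficient constraints kill every Taylor term of degree below `p`, so the combination of values of
`M` is of order `(h ξ) ^ p`. The `p` weights contribute a factor of order `(h ξ) ^ (-p)`. The powers
cancel, and `abs_summand_le` bounds each copy uniformly in `h`, `ξ`, `x` and `N`.

Bias. No weak derivative is integrated by parts. For a set `w` of directions, the average over `V`
retains, up to one further power of `h`, only the Taylor coefficient of the square-free monomial of
`w`. The forward difference of `M` in the directions of `w` isolates the same coefficient. After
multiplication by weights of size `h ^ (-|w|)` the two differ by `O(h)`
(`abs_integral_mul_prod_sub_le`). The weighted forward differences add up to a tensor product of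
one-dimensional operators. In one dimension, an exact identity (`IsDensityOn.integral_diffWeight`)
turns the weight into averages of the function over intervals of length `h`, which recover the value
at `x` up to `O(h)` for a Lipschitz function. Induction on the dimension
(`abs_integral_vertexSum_sub_le`) makes the bias `O(h)`. Since `h = c N ^ (-η)` with `η > 1/2`, its
square is `O(1 / N)`. -/

/-! ### Taylor polynomials and the coefficient constraints -/

theorem enorm2_nonneg {d : ℕ} (x : Fin d → ℝ) : 0 ≤ enorm2 x := norm_nonneg _

theorem enorm2_smul {d : ℕ} (t : ℝ) (x : Fin d → ℝ) : enorm2 (t • x) = |t| * enorm2 x := by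
  simp [enorm2, WithLp.toLp_smul, norm_smul]

theorem enorm2_le {d : ℕ} {x : Fin d → ℝ} {b : ℝ} (hb : 0 ≤ b) (hx : ∀ k, |x k| ≤ b) :
    enorm2 x ≤ d * b := by
  rw [enorm2, EuclideanSpace.norm_eq]
  refine Real.sqrt_le_iff.mpr ⟨by positivity, ?_⟩
  have h1 : ∑ k, ‖(WithLp.toLp 2 x : EuclideanSpace ℝ (Fin d)) k‖ ^ 2 ≤ ∑ _k : Fin d, b ^ 2 :=
    Finset.sum_le_sum fun k _ => pow_le_pow_left₀ (norm_nonneg _) (hx k) 2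
  have h2 : (d : ℝ) ≤ (d : ℝ) ^ 2 := by exact_mod_cast Nat.le_self_pow two_ne_zero d
  refine h1.trans ?_
  rw [Finset.sum_const, Finset.card_univ, Fintype.card_fin, nsmul_eq_mul, mul_pow]
  gcongr

/-- The polynomial of degree `< n` with coefficients `a`. -/
noncomputable def taylorSum {d : ℕ} (n : ℕ) (a : (Fin d → ℕ) → ℝ) (z : Fin d → ℝ) : ℝ :=
  ∑ r ∈ Finset.range n, ∑ i ∈ Finset.piAntidiag (Finset.univ : Finset (Fin d)) r,
    a i * ∏ k, z k ^ i k

theorem InHolder.exists_taylor {d α : ℕ} {A : ℝ} {M : (Fin d → ℝ) → ℝ} (hM : InHolder α A M)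
    (y : Fin d → ℝ) : ∃ a : (Fin d → ℕ) → ℝ, ∀ z,
      |M (y + z) - taylorSum α a z| ≤ A * enorm2 z ^ α := by
  obtain ⟨D, -, hD⟩ := hM
  refine ⟨fun i => D i y / ∏ k, ((i k).factorial : ℝ), fun z => ?_⟩
  have := hD (y + z) y
  simpa [taylorSum] using this

theorem InHolder.abs_le {d : ℕ} {A : ℝ} {M : (Fin d → ℝ) → ℝ} (hM : InHolder 0 A M)
    (y : Fin d → ℝ) : |M y| ≤ A := by
  obtain ⟨D, -, hD⟩ := hM
  simpa using hD y y

theorem InHolder.abs_sub_le {d : ℕ} {A : ℝ} {M : (Fin d → ℝ) → ℝ} (hM : InHolder 1 A M)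
    (x y : Fin d → ℝ) : |M x - M y| ≤ A * enorm2 (x - y) := by
  obtain ⟨D, -, hD⟩ := hM
  have h0 := hD y y
  have h1 := hD x y
  simp [enorm2, sub_eq_zero] at h0 h1
  rw [h0]
  simpa [enorm2] using h1

theorem InHolder.abs_sub_le_norm {d : ℕ} {A : ℝ} {M : (Fin d → ℝ) → ℝ} (hM : InHolder 1 A M)
    (hA : 0 ≤ A) (x y : Fin d → ℝ) : |M x - M y| ≤ A * d * ‖x - y‖ := by
  refine (hM.abs_sub_le x y).trans ?_
  rw [mul_assoc]
  exact mul_le_mul_of_nonneg_left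
    (enorm2_le (norm_nonneg _) fun k => by simpa using norm_le_pi_norm (x - y) k) hA

theorem continuous_of_abs_sub_le {E : Type*} [SeminormedAddCommGroup E] {M : E → ℝ} {Λ : ℝ}
    (hM : ∀ x y, |M x - M y| ≤ Λ * ‖x - y‖) : Continuous M := by
  refine (LipschitzWith.of_dist_le_mul (K := Λ.toNNReal) fun x y => ?_).continuous
  rw [Real.dist_eq, dist_eq_norm]
  exact (hM x y).trans (mul_le_mul_of_nonneg_right (Real.le_coe_toNNReal Λ) (norm_nonneg _))

/-- The part of degree `r` is homogeneous, so scaling by `β l` multiplies it by `β l ^ r`. Only the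
moments of the coefficients remain, which is what the constraints prescribe. -/
theorem sum_mul_taylorSum_smul {d L n : ℕ} (b β : Fin L → ℝ) (a : (Fin d → ℕ) → ℝ)
    (z : Fin d → ℝ) :
    ∑ l, b l * taylorSum n a (β l • z) = ∑ r ∈ Finset.range n, (∑ l, b l * β l ^ r) *
      ∑ i ∈ Finset.piAntidiag (Finset.univ : Finset (Fin d)) r, a i * ∏ k, z k ^ i k := by
  simp only [taylorSum, Finset.mul_sum, Finset.sum_mul]
  rw [Finset.sum_comm]
  refine Finset.sum_congr rfl fun r _ => ?_
  rw [Finset.sum_comm]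
  refine Finset.sum_congr rfl fun i hi => Finset.sum_congr rfl fun l _ => ?_
  have hs : ∑ k, i k = r := (Finset.mem_piAntidiag.mp hi).1
  simp only [Pi.smul_apply, smul_eq_mul, mul_pow, Finset.prod_mul_distrib]
  rw [Finset.prod_pow_eq_pow_sum, hs]
  ring

theorem abs_sum_mul_sub_taylorSum_le {d L n : ℕ} {A : ℝ} {M : (Fin d → ℝ) → ℝ}
    {a : (Fin d → ℕ) → ℝ} {y : Fin d → ℝ}
    (ha : ∀ z, |M (y + z) - taylorSum n a z| ≤ A * enorm2 z ^ n)
    (b β : Fin L → ℝ) (z : Fin d → ℝ) :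
    |∑ l, b l * M (y + β l • z) - ∑ l, b l * taylorSum n a (β l • z)|
      ≤ A * (∑ l, |b l * β l ^ n|) * enorm2 z ^ n := by
  rw [← Finset.sum_sub_distrib, Finset.mul_sum, Finset.sum_mul]
  refine (Finset.abs_sum_le_sum_abs _ _).trans (Finset.sum_le_sum fun l _ => ?_)
  rw [← mul_sub, abs_mul, abs_mul, abs_pow]
  calc |b l| * |M (y + β l • z) - taylorSum n a (β l • z)|
      ≤ |b l| * (A * enorm2 (β l • z) ^ n) := by gcongr; exact ha _
    _ = _ := by rw [enorm2_smul]; ring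

/-- Only exponents up to `p` are needed. They are all covered by the range `0, …, d - 1`, except `r
= p = d`, which is the third clause with `j = 0`. -/
theorem CoeffConstraints.sum_eq {d : ℕ} {β : Fin (d + 1) → ℝ}
    {C : ℕ → Fin (d + 1) → ℝ} (hC : CoeffConstraints d (d - 1) β C) {p r : ℕ}
    (hp : p ∈ Finset.Icc 1 d) (hr : r ≤ p) :
    ∑ l, C p l * β l ^ r = if p = r then 1 else 0 := by
  have hp' := Finset.mem_Icc.mp hp
  refine hC p hp r ?_
  rcases Nat.lt_or_ge (d - 1) r with h | h
  · exact Or.inr (Or.inr ⟨by omega, 0, by omega, by omega⟩)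
  · exact Or.inl h

theorem CoeffConstraints.sum_range_eq_zero {d : ℕ} {β : Fin (d + 1) → ℝ}
    {C : ℕ → Fin (d + 1) → ℝ} (hC : CoeffConstraints d (d - 1) β C) {p : ℕ}
    (hp : p ∈ Finset.Icc 1 d) (q : ℕ → ℝ) :
    ∑ r ∈ Finset.range p, (∑ l, C p l * β l ^ r) * q r = 0 :=
  Finset.sum_eq_zero fun r hr => by
    have hr := Finset.mem_range.mp hr
    rw [hC.sum_eq hp hr.le, if_neg hr.ne', zero_mul]

/-- All moments below `p` vanish, so the Taylor polynomial of degree `p - 1` disappears and only the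
remainder of order `p` is left. This gain compensates the singular weights in the variance. -/
theorem CoeffConstraints.abs_sum_le {d : ℕ} {β : Fin (d + 1) → ℝ}
    {C : ℕ → Fin (d + 1) → ℝ} (hC : CoeffConstraints d (d - 1) β C) {p : ℕ}
    (hp : p ∈ Finset.Icc 1 d) {A : ℝ} {M : (Fin d → ℝ) → ℝ} (hM : InHolder p A M)
    (y z : Fin d → ℝ) :
    |∑ l, C p l * M (y + β l • z)| ≤ A * Gam β C p p * enorm2 z ^ p := by
  obtain ⟨a, ha⟩ := hM.exists_taylor y
  have h := abs_sum_mul_sub_taylorSum_le ha (C p) β z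
  rwa [sum_mul_taylorSum_smul, hC.sum_range_eq_zero hp, sub_zero] at h

/-- With one more Taylor order, the part of degree `p` survives with coefficient exactly 1. This is
the version needed for the bias. -/
theorem CoeffConstraints.abs_sum_sub_le {d : ℕ} {β : Fin (d + 1) → ℝ}
    {C : ℕ → Fin (d + 1) → ℝ} (hC : CoeffConstraints d (d - 1) β C) {p : ℕ}
    (hp : p ∈ Finset.Icc 1 d) {A : ℝ} {M : (Fin d → ℝ) → ℝ} {y : Fin d → ℝ}
    {a : (Fin d → ℕ) → ℝ}
    (ha : ∀ z, |M (y + z) - taylorSum (p + 1) a z| ≤ A * enorm2 z ^ (p + 1)) (z : Fin d → ℝ) :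
    |∑ l, C p l * M (y + β l • z)
      - ∑ i ∈ Finset.piAntidiag (Finset.univ : Finset (Fin d)) p, a i * ∏ k, z k ^ i k|
      ≤ A * Gam β C p (p + 1) * enorm2 z ^ (p + 1) := by
  have h := abs_sum_mul_sub_taylorSum_le ha (C p) β z
  rwa [sum_mul_taylorSum_smul, Finset.sum_range_succ, hC.sum_range_eq_zero hp, zero_add,
    hC.sum_eq hp le_rfl, if_pos rfl, one_mul] at h

/-- The multi-index of the cross-partial derivative in the directions of `w`. -/
def crossIndex {d : ℕ} (w : Finset (Fin d)) : Fin d → ℕ := fun k => if k ∈ w then 1 else 0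

theorem sum_crossIndex {d : ℕ} (w : Finset (Fin d)) : ∑ k, crossIndex w k = w.card := by
  simp [crossIndex]

/-- The hypotheses give `crossIndex w ≤ i` pointwise with no room left in the total.
Contrapositively, any other multi-index of this degree misses a direction of `w`, which makes its
contribution vanish both for differences and for moments. -/
theorem eq_crossIndex_of_le {d : ℕ} {w : Finset (Fin d)} {i : Fin d → ℕ}
    (hle : ∀ k ∈ w, 1 ≤ i k) (hs : ∑ k, i k ≤ w.card) : i = crossIndex w := by
  have h1 : ∀ k ∈ Finset.univ, crossIndex w k ≤ i k := by
    intro k _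
    unfold crossIndex
    split_ifs with hk
    · exact hle k hk
    · exact Nat.zero_le _
  have h2 : ∑ k, crossIndex w k = ∑ k, i k :=
    le_antisymm (Finset.sum_le_sum h1) (hs.trans (sum_crossIndex w).ge)
  funext k
  exact ((Finset.sum_eq_sum_iff_of_le h1).mp h2 k (Finset.mem_univ k)).symm

theorem crossIndex_mem {d : ℕ} (w : Finset (Fin d)) :
    crossIndex w ∈ Finset.piAntidiag (Finset.univ : Finset (Fin d)) w.card :=
  Finset.mem_piAntidiag.mpr ⟨sum_crossIndex w, fun k _ => Finset.mem_univ k⟩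

/-! ### Forward differences -/

/-- The vertex of the cube of side `h` selected by `u`. -/
noncomputable def vertex {d : ℕ} (h : ℝ) (u : Fin d → Bool) : Fin d → ℝ :=
  fun k => if u k then h else 0

/-- The coefficient of the vertex `u` in the forward difference in the directions of `w`. -/
noncomputable def diffCoeff {d : ℕ} (w : Finset (Fin d)) (u : Fin d → Bool) : ℝ :=
  ∏ k, if k ∈ w then (if u k then 1 else -1) else (if u k then 0 else 1)

/-- The forward difference of `M` at `y` with step `h` in the directions of `w`. -/
noncomputable def forwardDiff {d : ℕ} (w : Finset (Fin d)) (h : ℝ) (M : (Fin d → ℝ) → ℝ)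
    (y : Fin d → ℝ) : ℝ :=
  ∑ u : Fin d → Bool, diffCoeff w u * M (y + vertex h u)

theorem abs_diffCoeff_le {d : ℕ} (w : Finset (Fin d)) (u : Fin d → Bool) :
    |diffCoeff w u| ≤ 1 := by
  rw [diffCoeff, Finset.abs_prod]
  refine Finset.prod_le_one (fun k _ => abs_nonneg _) fun k _ => ?_
  split_ifs <;> simp

/-- The sum over vertices factors over coordinates. A direction of `w` with exponent 0 contributes
the factor `1 - 1`. -/
theorem sum_diffCoeff_mul_prod {d : ℕ} (w : Finset (Fin d)) (h : ℝ) (i : Fin d → ℕ)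
    (hi : ∑ k, i k ≤ w.card) :
    ∑ u : Fin d → Bool, diffCoeff w u * ∏ k, vertex h u k ^ i k
      = if i = crossIndex w then h ^ w.card else 0 := by
  have h1 : ∑ u : Fin d → Bool, diffCoeff w u * ∏ k, vertex h u k ^ i k
      = ∏ k, ∑ b : Bool, (if k ∈ w then (if b then (1 : ℝ) else -1) else (if b then 0 else 1))
        * (if b then h else 0) ^ i k := by
    rw [Finset.prod_univ_sum, Fintype.piFinset_univ]
    refine Finset.sum_congr rfl fun u _ => ?_
    rw [diffCoeff, ← Finset.prod_mul_distrib]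
    rfl
  rw [h1]
  split_ifs with hw
  · subst hw
    have : ∀ k : Fin d, (∑ b : Bool, (if k ∈ w then (if b then (1 : ℝ) else -1)
        else (if b then 0 else 1)) * (if b then h else 0) ^ crossIndex w k)
        = if k ∈ w then h else 1 := by
      intro k
      by_cases hk : k ∈ w <;> simp [hk, crossIndex]
    rw [Finset.prod_congr rfl fun k _ => this k]
    simp
  · have : ∃ k ∈ w, i k = 0 := by
      by_contra! hcon
      exact hw (eq_crossIndex_of_le (fun k hk => Nat.one_le_iff_ne_zero.mpr (hcon k hk)) hi)
    obtain ⟨k, hk, hk0⟩ := this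
    refine Finset.prod_eq_zero (Finset.mem_univ k) ?_
    simp [hk, hk0]

/-- On the Taylor polynomial the difference sees only the square-free monomial of `w`. The remainder
is paid once at each of the `2 ^ d` vertices. -/
theorem abs_forwardDiff_sub_le {d : ℕ} (w : Finset (Fin d)) {h A : ℝ} (hh : 0 ≤ h) (hA : 0 ≤ A)
    {M : (Fin d → ℝ) → ℝ} {y : Fin d → ℝ} {a : (Fin d → ℕ) → ℝ}
    (ha : ∀ z, |M (y + z) - taylorSum (w.card + 1) a z| ≤ A * enorm2 z ^ (w.card + 1)) :
    |forwardDiff w h M y - a (crossIndex w) * h ^ w.card|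
      ≤ 2 ^ d * (A * (d * h) ^ (w.card + 1)) := by
  have h1 : ∑ u : Fin d → Bool, diffCoeff w u * taylorSum (w.card + 1) a (vertex h u)
      = a (crossIndex w) * h ^ w.card := by
    simp only [taylorSum, Finset.mul_sum]
    rw [Finset.sum_comm]
    have h2 : ∀ r ∈ Finset.range (w.card + 1),
        ∑ u : Fin d → Bool, ∑ i ∈ Finset.piAntidiag (Finset.univ : Finset (Fin d)) r,
          diffCoeff w u * (a i * ∏ k, vertex h u k ^ i k)
        = if r = w.card then a (crossIndex w) * h ^ w.card else 0 := by
      intro r hr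
      rw [Finset.sum_comm]
      have h3 : ∀ i ∈ Finset.piAntidiag (Finset.univ : Finset (Fin d)) r,
          ∑ u : Fin d → Bool, diffCoeff w u * (a i * ∏ k, vertex h u k ^ i k)
          = if i = crossIndex w then a (crossIndex w) * h ^ w.card else 0 := by
        intro i hi
        have hs : ∑ k, i k = r := (Finset.mem_piAntidiag.mp hi).1
        have hr := Finset.mem_range.mp hr
        have := sum_diffCoeff_mul_prod w h i (by omega)
        rw [Finset.sum_congr rfl fun u _ => mul_left_comm _ _ _, ← Finset.mul_sum, this]
        split_ifs with hw
        · rw [hw]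
        · simp
      rw [Finset.sum_congr rfl h3, Finset.sum_ite_eq']
      by_cases hrw : r = w.card
      · rw [if_pos hrw, if_pos (hrw ▸ crossIndex_mem w)]
      · rw [if_neg hrw, if_neg]
        intro hmem
        exact hrw ((Finset.mem_piAntidiag.mp hmem).1.symm.trans (sum_crossIndex w))
    rw [Finset.sum_congr rfl h2, Finset.sum_ite_eq', if_pos (by simp)]
  rw [← h1, forwardDiff, ← Finset.sum_sub_distrib]
  refine (Finset.abs_sum_le_sum_abs _ _).trans ?_
  have h4 : ∀ u ∈ (Finset.univ : Finset (Fin d → Bool)),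
      |diffCoeff w u * M (y + vertex h u)
        - diffCoeff w u * taylorSum (w.card + 1) a (vertex h u)|
      ≤ A * (d * h) ^ (w.card + 1) := by
    intro u _
    rw [← mul_sub, abs_mul]
    have h5 : enorm2 (vertex h u) ≤ d * h :=
      enorm2_le hh fun k => by
        unfold vertex
        split_ifs
        · exact (abs_of_nonneg hh).le
        · simpa using hh
    calc _ ≤ 1 * (A * enorm2 (vertex h u) ^ (w.card + 1)) :=
          mul_le_mul (abs_diffCoeff_le w u) (ha _) (abs_nonneg _) zero_le_one
      _ ≤ _ := by
        rw [one_mul]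
        exact mul_le_mul_of_nonneg_left (pow_le_pow_left₀ (enorm2_nonneg _) h5 _) hA
  refine (Finset.sum_le_sum h4).trans ?_
  simp

/-- Summing weighted forward differences over all sets of directions. -/
theorem sum_prod_mul_forwardDiff {d : ℕ} (a : Fin d → ℝ) (h : ℝ) (M : (Fin d → ℝ) → ℝ)
    (y : Fin d → ℝ) :
    ∑ w : Finset (Fin d), (∏ k ∈ w, a k) * forwardDiff w h M y
      = ∑ u : Fin d → Bool, (∏ k, if u k then a k else 1 - a k) * M (y + vertex h u) := by
  simp only [forwardDiff, Finset.mul_sum]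
  rw [Finset.sum_comm]
  refine Finset.sum_congr rfl fun u _ => ?_
  -- Splitting each factor into a multiple of `a k` and a constant lets the product expand over
  -- subsets, which are the sets `w`.
  have h1 : ∏ k, (if u k then a k else 1 - a k)
      = ∏ k, (a k * (if u k then 1 else -1) + (if u k then 0 else 1)) :=
    Finset.prod_congr rfl fun k _ => by split_ifs <;> ring
  rw [h1, Fintype.prod_add, Finset.sum_mul]
  refine Finset.sum_congr rfl fun w _ => ?_
  rw [← mul_assoc]
  congr 1
  rw [diffCoeff, Finset.prod_ite, Finset.prod_mul_distrib, ← mul_assoc]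
  have hw : Finset.univ.filter (fun k => k ∈ w) = w := by ext k; simp
  have hw' : Finset.univ.filter (fun k => k ∉ w) = wᶜ := by ext k; simp
  rw [hw, hw']

/-! ### Laws with a density -/

theorem IsDensityOn.isProbabilityMeasure {g : ℝ → ℝ} {I : Set ℝ} (hg : IsDensityOn g I) :
    IsProbabilityMeasure (densityLaw g) := by
  refine ⟨?_⟩
  rw [densityLaw, withDensity_apply _ MeasurableSet.univ, Measure.restrict_univ]
  exact hg.lintegral_eq_one

theorem IsDensityOn.integral_eq {g : ℝ → ℝ} {I : Set ℝ} (hg : IsDensityOn g I)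
    (hI : MeasurableSet I) (H : ℝ → ℝ) : ∫ t, H t ∂(densityLaw g) = ∫ t in I, g t * H t := by
  rw [densityLaw, integral_withDensity_eq_integral_toReal_smul
    hg.measurable.ennreal_ofReal (ae_of_all _ fun _ => ENNReal.ofReal_lt_top)]
  rw [← integral_indicator hI]
  refine integral_congr_ae (ae_of_all _ fun t => ?_)
  by_cases ht : t ∈ I
  · simp [ht, ENNReal.toReal_ofReal (hg.nonneg t)]
  · simp [ht, hg.zero_outside t ht]

theorem IsDensityOn.ae_mem {g : ℝ → ℝ} {I : Set ℝ} (hg : IsDensityOn g I)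
    (hI : MeasurableSet I) : ∀ᵐ t ∂(densityLaw g), t ∈ I := by
  rw [ae_iff]
  change densityLaw g Iᶜ = 0
  rw [densityLaw, withDensity_apply _ hI.compl,
    setLIntegral_congr_fun (g := fun _ => 0) hI.compl
      (fun t ht => by simp [hg.zero_outside t ht])]
  simp

/-- The density has total mass 1, so the volume is at most `1 / ρ`. This makes Lebesgue measure on
`I` finite, so that bounded integrands are integrable in the Fubini step. -/
theorem IsDensityOn.volume_lt_top {g : ℝ → ℝ} {I : Set ℝ} (hg : IsDensityOn g I)
    (hI : MeasurableSet I) {ρ : ℝ} (hρ : 0 < ρ) (hb : ∀ t ∈ I, ρ ≤ g t) : volume I < ⊤ := by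
  have h1 : ENNReal.ofReal ρ * volume I ≤ 1 := by
    rw [← setLIntegral_const, ← hg.lintegral_eq_one]
    refine (setLIntegral_mono_ae' hI (ae_of_all _ fun t ht => ?_)).trans
      (setLIntegral_le_lintegral I _)
    exact ENNReal.ofReal_le_ofReal (hb t ht)
  by_contra! htop
  rw [top_le_iff.mp htop, ENNReal.mul_top (by simpa using hρ)] at h1
  simp at h1

theorem measurable_step (x : ℝ) : Measurable fun s : ℝ => if x ≤ s then (1 : ℝ) else 0 :=
  Measurable.ite measurableSet_Ici measurable_const measurable_const

theorem abs_cdf_sub_step_le (μ : Measure ℝ) (x s : ℝ) :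
    |cdf μ s - if x ≤ s then 1 else 0| ≤ 1 := by
  have h0 := cdf_nonneg μ s
  have h1 := cdf_le_one μ s
  split_ifs <;> rw [abs_le] <;> constructor <;> linarith

/-- For `z ≤ x` the difference of the steps is the indicator of `[z, x)`, which lies in `I` because
`I` is an interval; the other order follows by antisymmetry. -/
theorem setIntegral_step_sub_step {I : Set ℝ} (hI : I.OrdConnected) {x z : ℝ}
    (hx : x ∈ I) (hz : z ∈ I) (F : ℝ → ℝ) :
    ∫ s in I, ((if z ≤ s then (1 : ℝ) else 0) - if x ≤ s then 1 else 0) * F s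
      = ∫ s in z..x, F s := by
  have key : ∀ a b : ℝ, a ∈ I → b ∈ I → a ≤ b →
      ∫ s in I, ((if a ≤ s then (1 : ℝ) else 0) - if b ≤ s then 1 else 0) * F s
        = ∫ s in a..b, F s := by
    intro a b ha hb hab
    have h1 : (fun s => ((if a ≤ s then (1 : ℝ) else 0) - if b ≤ s then 1 else 0) * F s)
        = (Set.Ico a b).indicator F := by
      funext s
      by_cases h1 : a ≤ s <;> by_cases h2 : b ≤ s
      · simp [h1, h2]
      · simp [h1, not_le.mp h2, h2]
      · exact absurd (hab.trans h2) h1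
      · simp [h1, h2]
    rw [h1, setIntegral_indicator measurableSet_Ico,
      Set.inter_eq_right.mpr (Set.Ico_subset_Icc_self.trans (hI.out ha hb)),
      intervalIntegral.integral_of_le hab, integral_Ico_eq_integral_Ioc]
  rcases le_total z x with h | h
  · exact key z x hz hx h
  · rw [intervalIntegral.integral_symm, ← key x z hx hz h, ← integral_neg]
    congr 1
    funext s
    ring

theorem integrable_of_abs_le {α : Type*} [MeasurableSpace α] {μ : Measure α} [IsFiniteMeasure μ]
    {f : α → ℝ} (hf : AEStronglyMeasurable f μ) {B : ℝ} (hB : ∀ᵐ x ∂μ, |f x| ≤ B) :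
    Integrable f μ :=
  Integrable.of_bound hf B hB

theorem intervalIntegrable_of_abs_le {e : ℝ → ℝ} (he : Measurable e) {B : ℝ}
    (hB : ∀ s, |e s| ≤ B) (a b : ℝ) : IntervalIntegrable e volume a b :=
  ⟨integrable_of_abs_le he.aestronglyMeasurable (ae_of_all _ hB),
    integrable_of_abs_le he.aestronglyMeasurable (ae_of_all _ hB)⟩

/-- The distribution function at `s` is the expectation over `z` of the step at `z`; exchanging the
two integrals leaves a difference of two steps. -/
theorem IsDensityOn.integral_cdf_sub_step {g : ℝ → ℝ} {I : Set ℝ} (hg : IsDensityOn g I)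
    (hI : IsOpen I) (hc : I.OrdConnected) {ρ : ℝ} (hρ : 0 < ρ) (hb : ∀ t ∈ I, ρ ≤ g t)
    {x : ℝ} (hx : x ∈ I) {F : ℝ → ℝ} (hF : Measurable F) {B : ℝ} (hB : ∀ s, |F s| ≤ B) :
    ∫ s in I, (cdf (densityLaw g) s - if x ≤ s then 1 else 0) * F s
      = ∫ z, (∫ s in z..x, F s) ∂(densityLaw g) := by
  have := hg.isProbabilityMeasure
  have : IsFiniteMeasure (volume.restrict I) :=
    ⟨by simpa using hg.volume_lt_top hI.measurableSet hρ hb⟩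
  have h1 : ∀ s, (cdf (densityLaw g) s - if x ≤ s then 1 else 0) * F s
      = ∫ z, ((if z ≤ s then (1 : ℝ) else 0) - if x ≤ s then 1 else 0) * F s
        ∂(densityLaw g) := by
    intro s
    rw [integral_mul_const, integral_sub, integral_const, cdf_eq_real]
    · have h2 : (fun z => if z ≤ s then (1 : ℝ) else 0)
          = (Set.Iic s).indicator (fun _ => (1 : ℝ)) := by
        funext z
        simp [Set.indicator_apply]
      rw [h2, integral_indicator_const _ measurableSet_Iic]
      simp
    · refine integrable_of_abs_le (B := 1) (Measurable.ite measurableSet_Iic measurable_const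
        measurable_const).aestronglyMeasurable (ae_of_all _ fun z => ?_)
      split_ifs <;> simp
    · exact integrable_const _
  simp_rw [h1]
  rw [integral_integral_swap]
  · refine integral_congr_ae ?_
    filter_upwards [hg.ae_mem hI.measurableSet] with z hz
    exact setIntegral_step_sub_step hc hx hz F
  · refine integrable_of_abs_le (B := B) ?_ (ae_of_all _ fun p => ?_)
    · refine Measurable.aestronglyMeasurable ?_
      refine Measurable.mul (Measurable.sub ?_ ?_) (hF.comp measurable_fst)
      · exact Measurable.ite (measurableSet_le measurable_snd measurable_fst)
          measurable_const measurable_const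
      · exact (measurable_step x).comp measurable_fst
    · have h2 := hB p.1
      have h3 := (abs_nonneg _).trans h2
      simp only [Function.uncurry]
      split_ifs <;> simp <;> first | exact h2 | exact h3

/-! ### The centering identity in one dimension -/

/-- The weight that turns forward differences of step `h` into a centering of the law `g`. -/
noncomputable def diffWeight (g : ℝ → ℝ) (h x s : ℝ) : ℝ :=
  (cdf (densityLaw g) s - if x ≤ s then 1 else 0) / (g s * h)

theorem IsDensityOn.measurable_diffWeight {g : ℝ → ℝ} {I : Set ℝ} (hg : IsDensityOn g I)
    (h x : ℝ) : Measurable (diffWeight g h x) :=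
  ((monotone_cdf (densityLaw g)).measurable.sub (measurable_step x)).div
    (hg.measurable.mul_const h)

theorem abs_diffWeight_le {g : ℝ → ℝ} {ρ : ℝ} (hρ : 0 < ρ) {h x s : ℝ} (hh : 0 < h)
    (hs : ρ ≤ g s) : |diffWeight g h x s| ≤ 1 / (ρ * h) := by
  rw [diffWeight, abs_div, abs_of_pos (mul_pos (hρ.trans_le hs) hh)]
  exact div_le_div₀ zero_le_one (abs_cdf_sub_step_le _ x s) (by positivity) (by gcongr)

theorem abs_average_sub_le {e : ℝ → ℝ} (he : Measurable e) {B : ℝ} (hB : ∀ s, |e s| ≤ B)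
    {z h c δ : ℝ} (hh : 0 < h) (hδ : ∀ s, z ≤ s → s ≤ z + h → |e s - c| ≤ δ) :
    |(1 / h) * (∫ s in z..(z + h), e s) - c| ≤ δ := by
  have h1 : (1 / h) * (∫ s in z..(z + h), e s) - c
      = (1 / h) * ∫ s in z..(z + h), (e s - c) := by
    rw [intervalIntegral.integral_sub (intervalIntegrable_of_abs_le he hB _ _) (by simp)]
    simp
    field_simp
  have h2 : ‖∫ s in z..(z + h), (e s - c)‖ ≤ δ * |z + h - z| :=
    intervalIntegral.norm_integral_le_of_norm_le_const fun s hs => by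
      rw [Set.uIoc_of_le (by linarith)] at hs
      exact hδ s hs.1.le hs.2
  rw [Real.norm_eq_abs, add_sub_cancel_left, abs_of_pos hh] at h2
  rw [h1, abs_mul, abs_of_pos (by positivity)]
  calc 1 / h * |∫ s in z..(z + h), (e s - c)| ≤ 1 / h * (δ * h) := by gcongr
    _ = δ := by field_simp

/-- The denominator of the weight cancels the density. The increments `e (s + h) - e s` then
telescope from `z` to `x` into two integrals over intervals of length `h`. Boundedness and
measurability of `e` suffice. -/
theorem IsDensityOn.integral_diffWeight {g : ℝ → ℝ} {I : Set ℝ} (hg : IsDensityOn g I)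
    (hI : IsOpen I) (hc : I.OrdConnected) {ρ : ℝ} (hρ : 0 < ρ) (hb : ∀ t ∈ I, ρ ≤ g t)
    {x : ℝ} (hx : x ∈ I) {h : ℝ} (hh : 0 < h) {e : ℝ → ℝ} (he : Measurable e) {B : ℝ}
    (hB : ∀ s, |e s| ≤ B) :
    ∫ s, ((1 - diffWeight g h x s) * e s + diffWeight g h x s * e (s + h)) ∂(densityLaw g)
      = ∫ z, (e z + ((1 / h) * (∫ s in x..(x + h), e s)
          - (1 / h) * ∫ s in z..(z + h), e s)) ∂(densityLaw g) := by
  have := hg.isProbabilityMeasure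
  have heh : Measurable fun s => e (s + h) := he.comp (measurable_id.add_const h)
  have hae : Integrable e (densityLaw g) :=
    integrable_of_abs_le he.aestronglyMeasurable (ae_of_all _ hB)
  have hF : Measurable fun s => e (s + h) - e s := heh.sub he
  have hFB : ∀ s, |e (s + h) - e s| ≤ B + B := fun s =>
    (abs_sub _ _).trans (add_le_add (hB _) (hB _))
  have hB0 : 0 ≤ B := (abs_nonneg _).trans (hB 0)
  have h1 : ∀ s, (1 - diffWeight g h x s) * e s + diffWeight g h x s * e (s + h)
      = e s + diffWeight g h x s * (e (s + h) - e s) := fun s => by ring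
  simp_rw [h1]
  rw [integral_add hae, hg.integral_eq hI.measurableSet
    (fun s => diffWeight g h x s * (e (s + h) - e s))]
  swap
  · refine integrable_of_abs_le (B := 1 / (ρ * h) * (B + B))
      ((hg.measurable_diffWeight h x).mul hF).aestronglyMeasurable ?_
    filter_upwards [hg.ae_mem hI.measurableSet] with s hs
    rw [abs_mul]
    exact mul_le_mul (abs_diffWeight_le hρ hh (hb s hs)) (hFB s) (abs_nonneg _) (by positivity)
  have h2 : ∫ s in I, g s * (diffWeight g h x s * (e (s + h) - e s))
      = (1 / h) * ∫ s in I, (cdf (densityLaw g) s - if x ≤ s then 1 else 0)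
        * (e (s + h) - e s) := by
    rw [← integral_const_mul]
    refine setIntegral_congr_fun hI.measurableSet fun s hs => ?_
    have : g s ≠ 0 := (hρ.trans_le (hb s hs)).ne'
    simp only [diffWeight]
    field_simp
  have h3 : ∀ z, ∫ s in z..x, (e (s + h) - e s)
      = (∫ s in x..(x + h), e s) - ∫ s in z..(z + h), e s := by
    intro z
    have hi := intervalIntegrable_of_abs_le he hB
    rw [intervalIntegral.integral_sub (intervalIntegrable_of_abs_le heh (fun s => hB _) _ _)
      (hi _ _), intervalIntegral.integral_comp_add_right]
    have h4 := intervalIntegral.integral_add_adjacent_intervals (hi z (z + h)) (hi (z + h) (x + h))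
    have h5 := intervalIntegral.integral_add_adjacent_intervals (hi z x) (hi x (x + h))
    linarith
  rw [h2, hg.integral_cdf_sub_step hI hc hρ hb hx hF hFB, ← integral_const_mul]
  simp_rw [h3]
  rw [← integral_add hae]
  · simp_rw [mul_sub]
  · have h6 : (fun z => 1 / h * ((∫ s in x..(x + h), e s) - ∫ s in z..(z + h), e s))
        = fun z => 1 / h * ∫ s in z..x, (e (s + h) - e s) := by
      funext z
      rw [h3]
    have h7 : Continuous fun z => ∫ s in z..x, (e (s + h) - e s) := by
      simp_rw [fun z => intervalIntegral.integral_symm (μ := volume)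
        (f := fun s => e (s + h) - e s) x z]
      exact (intervalIntegral.continuous_primitive
        (fun a b => intervalIntegrable_of_abs_le hF hFB a b) x).neg
    refine integrable_of_abs_le (B := B + B) ?_ (ae_of_all _ fun z => ?_)
    · rw [h6]
      exact (h7.const_mul _).aestronglyMeasurable
    · have h8 : ∀ z, |(1 / h) * (∫ s in z..(z + h), e s)| ≤ B := fun z => by
        simpa using abs_average_sub_le he hB (c := 0) hh (z := z) (δ := B)
          (fun s _ _ => by simpa using hB s)
      rw [mul_sub]
      exact (abs_sub _ _).trans (add_le_add (h8 x) (h8 z))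

/-- In the induction on the dimension, `e` is an integral over the other coordinates, known only to
be `ε`-close to a Lipschitz function `f`. The average at `x` costs one `ε`, the comparison of `e z`
with its average costs two, and each average costs `Λ * h`. -/
theorem IsDensityOn.abs_integral_diffWeight_sub_le {g : ℝ → ℝ} {I : Set ℝ}
    (hg : IsDensityOn g I) (hI : IsOpen I) (hc : I.OrdConnected) {ρ : ℝ} (hρ : 0 < ρ)
    (hb : ∀ t ∈ I, ρ ≤ g t) {x : ℝ} (hx : x ∈ I) {h : ℝ} (hh : 0 < h) {e : ℝ → ℝ}
    (he : Measurable e) {B : ℝ} (hB : ∀ s, |e s| ≤ B) {f : ℝ → ℝ} {Λ ε : ℝ} (hΛ : 0 ≤ Λ)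
    (hf : ∀ s t, |f s - f t| ≤ Λ * |s - t|) (hef : ∀ s, |e s - f s| ≤ ε) :
    |∫ s, ((1 - diffWeight g h x s) * e s + diffWeight g h x s * e (s + h)) ∂(densityLaw g)
      - f x| ≤ 3 * ε + 2 * Λ * h := by
  have := hg.isProbabilityMeasure
  rw [hg.integral_diffWeight hI hc hρ hb hx hh he hB]
  have h1 : ∀ z s, z ≤ s → s ≤ z + h → |f s - f z| ≤ Λ * h := fun z s h1 h2 =>
    (hf s z).trans (mul_le_mul_of_nonneg_left (by rw [abs_of_nonneg] <;> linarith) hΛ)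
  have h2 : |(1 / h) * (∫ s in x..(x + h), e s) - f x| ≤ ε + Λ * h := by
    refine abs_average_sub_le he hB hh fun s hs1 hs2 => ?_
    exact (abs_sub_le _ (f s) _).trans (add_le_add (hef s) (h1 x s hs1 hs2))
  have h3 : ∀ z, |(1 / h) * (∫ s in z..(z + h), e s) - e z| ≤ ε + Λ * h + ε := fun z => by
    refine abs_average_sub_le he hB hh fun s hs1 hs2 => ?_
    refine (abs_sub_le _ (f z) _).trans (add_le_add ?_ (by rw [abs_sub_comm]; exact hef z))
    exact (abs_sub_le _ (f s) _).trans (add_le_add (hef s) (h1 z s hs1 hs2))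
  have h4 : ∀ z, |e z + ((1 / h) * (∫ s in x..(x + h), e s)
      - (1 / h) * ∫ s in z..(z + h), e s) - f x| ≤ 3 * ε + 2 * Λ * h := fun z => by
    have := abs_le.mp h2
    have := abs_le.mp (h3 z)
    rw [abs_le]
    constructor <;> linarith
  have hint : Integrable (fun z => e z + ((1 / h) * (∫ s in x..(x + h), e s)
      - (1 / h) * ∫ s in z..(z + h), e s)) (densityLaw g) := by
    refine integrable_of_abs_le (B := 3 * ε + 2 * Λ * h + |f x|) ?_ (ae_of_all _ fun z => ?_)
    · refine (he.add (measurable_const.sub (measurable_const.mul ?_))).aestronglyMeasurable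
      have hi := intervalIntegrable_of_abs_le he hB
      have h5 := intervalIntegral.continuous_primitive hi 0
      have h6 : (fun z => ∫ s in z..(z + h), e s)
          = fun z => (∫ s in (0 : ℝ)..(z + h), e s) - ∫ s in (0 : ℝ)..z, e s := by
        funext z
        rw [intervalIntegral.integral_interval_sub_left (hi _ _) (hi _ _)]
      rw [h6]
      exact ((h5.comp (continuous_id.add_const h)).sub h5).measurable
    · have := (abs_add_le (e z + ((1 / h) * (∫ s in x..(x + h), e s)
        - (1 / h) * ∫ s in z..(z + h), e s) - f x) (f x)).trans
        (add_le_add (h4 z) le_rfl)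
      rwa [sub_add_cancel] at this
  -- The constant `f x` is its own expectation, so the pointwise bound `h4` passes to the difference
  -- of integrals.
  have h5 : ∀ q : ℝ, q - f x = q - ∫ _z, f x ∂(densityLaw g) := fun q => by simp
  rw [h5, ← integral_sub hint (integrable_const _)]
  have := norm_integral_le_of_norm_le_const (μ := densityLaw g) (C := 3 * ε + 2 * Λ * h)
    (ae_of_all _ fun z => by rw [Real.norm_eq_abs]; exact h4 z)
  simpa using this

/-! ### Centering in several coordinates -/

theorem ae_mem_productLaw {d : ℕ} {f : Fin d → ℝ → ℝ} {I : Fin d → Set ℝ}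
    (hf : ∀ k, IsDensityOn (f k) (I k)) (hI : ∀ k, IsOpen (I k)) :
    ∀ᵐ y ∂(productLaw f), ∀ k, y k ∈ I k := by
  have := fun k => (hf k).isProbabilityMeasure
  rw [ae_all_iff]
  intro k
  exact (Measure.tendsto_eval_ae_ae (i := k)).eventually ((hf k).ae_mem (hI k).measurableSet)

/-- The coordinates have densities bounded below on open intervals. -/
structure IsLowerBounded {d : ℕ} (g : Fin d → ℝ → ℝ) (I : Fin d → Set ℝ) (ρ : ℝ) : Prop where
  density : ∀ k, IsDensityOn (g k) (I k)
  isOpen : ∀ k, IsOpen (I k)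
  ordConnected : ∀ k, (I k).OrdConnected
  pos : 0 < ρ
  le : ∀ k, ∀ t ∈ I k, ρ ≤ g k t

theorem IsLowerBounded.ae_mem {d : ℕ} {g : Fin d → ℝ → ℝ} {I : Fin d → Set ℝ} {ρ : ℝ}
    (hg : IsLowerBounded g I ρ) : ∀ᵐ y ∂(productLaw g), ∀ k, y k ∈ I k :=
  ae_mem_productLaw hg.density hg.isOpen

/-- The sum of the values of `f` at the vertices of a cube, weighted so that it represents
centering coordinate by coordinate. -/
noncomputable def vertexSum {d : ℕ} (g : Fin d → ℝ → ℝ) (h : ℝ) (x : Fin d → ℝ)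
    (f : (Fin d → ℝ) → ℝ) (y : Fin d → ℝ) : ℝ :=
  ∑ u : Fin d → Bool,
    (∏ k, if u k then diffWeight (g k) h (x k) (y k) else 1 - diffWeight (g k) h (x k) (y k))
      * f (y + vertex h u)

theorem measurable_diffWeight_ite {d : ℕ} {g : Fin d → ℝ → ℝ} {I : Fin d → Set ℝ} {ρ : ℝ}
    (hg : IsLowerBounded g I ρ) (h : ℝ) (x : Fin d → ℝ) (u : Fin d → Bool) :
    Measurable fun y : Fin d → ℝ => ∏ k, if u k then diffWeight (g k) h (x k) (y k)
      else 1 - diffWeight (g k) h (x k) (y k) := by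
  refine Finset.measurable_prod _ fun k _ => ?_
  have h1 : Measurable fun y : Fin d → ℝ => diffWeight (g k) h (x k) (y k) :=
    ((hg.density k).measurable_diffWeight h (x k)).comp (measurable_pi_apply k)
  by_cases hu : u k
  · simpa only [hu, if_true] using h1
  · simpa only [hu, Bool.false_eq_true, if_false] using h1.const_sub 1

theorem measurable_vertexSum {d : ℕ} {g : Fin d → ℝ → ℝ} {I : Fin d → Set ℝ} {ρ : ℝ}
    (hg : IsLowerBounded g I ρ) (h : ℝ) (x : Fin d → ℝ) {α : Type*} [MeasurableSpace α]
    {f : α → (Fin d → ℝ) → ℝ} (hf : Measurable (Function.uncurry f)) :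
    Measurable fun p : α × (Fin d → ℝ) => vertexSum g h x (f p.1) p.2 := by
  refine Finset.measurable_sum _ fun u _ =>
    ((measurable_diffWeight_ite hg h x u).comp measurable_snd).mul ?_
  exact hf.comp (measurable_fst.prodMk (measurable_snd.add_const _))

/-- This bound degenerates as `h → 0`; it serves only for integrability. -/
theorem abs_vertexSum_le {d : ℕ} {g : Fin d → ℝ → ℝ} {I : Fin d → Set ℝ} {ρ : ℝ}
    (hg : IsLowerBounded g I ρ) {h : ℝ} (hh : 0 < h) (x : Fin d → ℝ) {f : (Fin d → ℝ) → ℝ}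
    {B : ℝ} (hB : ∀ y, |f y| ≤ B) {y : Fin d → ℝ} (hy : ∀ k, y k ∈ I k) :
    |vertexSum g h x f y| ≤ 2 ^ d * ((1 + 1 / (ρ * h)) ^ d * B) := by
  have h1 : ∀ u ∈ (Finset.univ : Finset (Fin d → Bool)),
      |(∏ k, if u k then diffWeight (g k) h (x k) (y k)
        else 1 - diffWeight (g k) h (x k) (y k)) * f (y + vertex h u)|
      ≤ (1 + 1 / (ρ * h)) ^ d * B := by
    intro u _
    have hρ := hg.pos
    rw [abs_mul, Finset.abs_prod]
    refine mul_le_mul ?_ (hB _) (abs_nonneg _) (by positivity)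
    calc _ ≤ ∏ _k : Fin d, (1 + 1 / (ρ * h)) := by
          refine Finset.prod_le_prod (fun k _ => abs_nonneg _) fun k _ => ?_
          have h2 := abs_diffWeight_le (x := x k) hg.pos hh (hg.le k _ (hy k))
          split_ifs
          · linarith
          · exact (abs_sub _ _).trans (by simpa using h2)
      _ = _ := by simp
  refine (Finset.abs_sum_le_sum_abs _ _).trans ((Finset.sum_le_sum h1).trans ?_)
  simp

theorem IsLowerBounded.isProbabilityMeasure {d : ℕ} {g : Fin d → ℝ → ℝ} {I : Fin d → Set ℝ}
    {ρ : ℝ} (hg : IsLowerBounded g I ρ) : IsProbabilityMeasure (productLaw g) := by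
  have := fun k => (hg.density k).isProbabilityMeasure
  unfold productLaw
  infer_instance

theorem integrable_vertexSum {d : ℕ} {g : Fin d → ℝ → ℝ} {I : Fin d → Set ℝ} {ρ : ℝ}
    (hg : IsLowerBounded g I ρ) {h : ℝ} (hh : 0 < h) (x : Fin d → ℝ) {f : (Fin d → ℝ) → ℝ}
    (hf : Measurable f) {B : ℝ} (hB : ∀ y, |f y| ≤ B) :
    Integrable (vertexSum g h x f) (productLaw g) := by
  have := hg.isProbabilityMeasure
  refine integrable_of_abs_le (B := 2 ^ d * ((1 + 1 / (ρ * h)) ^ d * B)) ?_ ?_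
  · have h1 := measurable_vertexSum hg h x (α := Unit) (f := fun _ => f)
      (hf.comp measurable_snd)
    exact (h1.comp (measurable_const (a := ()) |>.prodMk measurable_id)).aestronglyMeasurable
  · filter_upwards [hg.ae_mem] with y hy
    exact abs_vertexSum_le hg hh x hB hy

/-- The vertices of the cube split by the first coordinate, and the weights are products. This is
the tensor structure on which the induction rests. -/
theorem vertexSum_cons {d : ℕ} (g : Fin (d + 1) → ℝ → ℝ) (h : ℝ) (x : Fin (d + 1) → ℝ)
    (f : (Fin (d + 1) → ℝ) → ℝ) (s : ℝ) (y : Fin d → ℝ) :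
    vertexSum g h x f (Fin.cons s y)
      = (1 - diffWeight (g 0) h (x 0) s)
          * vertexSum (fun k => g k.succ) h (Fin.tail x) (fun z => f (Fin.cons s z)) y
        + diffWeight (g 0) h (x 0) s
          * vertexSum (fun k => g k.succ) h (Fin.tail x) (fun z => f (Fin.cons (s + h) z)) y := by
  have h1 : ∀ (b : Bool) (u : Fin d → Bool),
      (Fin.cons s y : Fin (d + 1) → ℝ) + vertex h (Fin.cons b u : Fin (d + 1) → Bool)
        = Fin.cons (s + if b then h else 0) (y + vertex h u) := by
    intro b u
    funext k
    refine Fin.cases ?_ (fun k => ?_) k <;> simp [vertex]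
  have h2 : ∀ (b : Bool) (u : Fin d → Bool),
      (∏ k, if (Fin.cons b u : Fin (d + 1) → Bool) k
          then diffWeight (g k) h (x k) ((Fin.cons s y : Fin (d + 1) → ℝ) k)
          else 1 - diffWeight (g k) h (x k) ((Fin.cons s y : Fin (d + 1) → ℝ) k))
        = (if b then diffWeight (g 0) h (x 0) s else 1 - diffWeight (g 0) h (x 0) s)
          * ∏ k : Fin d, if u k then diffWeight (g k.succ) h (x k.succ) (y k)
            else 1 - diffWeight (g k.succ) h (x k.succ) (y k) := by
    intro b u
    rw [Fin.prod_univ_succ]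
    simp only [Fin.cons_zero, Fin.cons_succ]
  have h3 : vertexSum g h x f (Fin.cons s y) = ∑ b : Bool, ∑ u : Fin d → Bool,
      (∏ k, if (Fin.cons b u : Fin (d + 1) → Bool) k
          then diffWeight (g k) h (x k) ((Fin.cons s y : Fin (d + 1) → ℝ) k)
          else 1 - diffWeight (g k) h (x k) ((Fin.cons s y : Fin (d + 1) → ℝ) k))
        * f ((Fin.cons s y : Fin (d + 1) → ℝ)
          + vertex h (Fin.cons b u : Fin (d + 1) → Bool)) := by
    rw [vertexSum, ← (Fin.consEquiv fun _ => Bool).sum_comp, Fintype.sum_prod_type]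
    rfl
  rw [h3, Fintype.sum_bool, add_comm]
  simp only [h1, h2, vertexSum, Finset.mul_sum, Fin.tail, mul_assoc]
  simp

theorem integral_productLaw_succ {d : ℕ} {g : Fin (d + 1) → ℝ → ℝ} {I : Fin (d + 1) → Set ℝ}
    {ρ : ℝ} (hg : IsLowerBounded g I ρ) {F : (Fin (d + 1) → ℝ) → ℝ}
    (hF : Integrable F (productLaw g)) :
    ∫ y, F y ∂(productLaw g)
      = ∫ s, ∫ y, F (Fin.cons s y) ∂(productLaw fun k => g k.succ) ∂(densityLaw (g 0)) := by
  have := fun k => (hg.density k).isProbabilityMeasure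
  have h1 := (measurePreserving_piFinSuccAbove (fun k => densityLaw (g k)) 0).symm
  have h2 : ∀ p : ℝ × (Fin d → ℝ),
      (MeasurableEquiv.piFinSuccAbove (fun _ : Fin (d + 1) => ℝ) 0).symm p
        = Fin.cons p.1 p.2 := fun p => by
    simp [MeasurableEquiv.piFinSuccAbove, Fin.insertNthEquiv]
  have h3 := h1.integral_comp' F
  have h4 : Integrable (fun p => F ((MeasurableEquiv.piFinSuccAbove (fun _ => ℝ) 0).symm p)) _ :=
    (h1.integrable_comp_emb (MeasurableEquiv.measurableEmbedding _)).mpr hF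
  rw [productLaw, ← h3, integral_prod _ h4]
  simp only [h2]
  rfl

theorem IsLowerBounded.tail {d : ℕ} {g : Fin (d + 1) → ℝ → ℝ} {I : Fin (d + 1) → Set ℝ} {ρ : ℝ}
    (hg : IsLowerBounded g I ρ) : IsLowerBounded (fun k => g k.succ) (fun k => I k.succ) ρ :=
  ⟨fun _ => hg.density _, fun _ => hg.isOpen _, fun _ => hg.ordConnected _, hg.pos,
    fun _ => hg.le _⟩

/-- Integrating out the last coordinates first leaves a one-dimensional problem for `Φ`, close to a
slice of `f` by induction. The constant satisfies `3 * (3 ^ d - 1) + 2 = 3 ^ (d + 1) - 1`. -/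
theorem abs_integral_vertexSum_sub_le {d : ℕ} {g : Fin d → ℝ → ℝ} {I : Fin d → Set ℝ} {ρ : ℝ}
    (hg : IsLowerBounded g I ρ) {h : ℝ} (hh : 0 < h) {x : Fin d → ℝ} (hx : ∀ k, x k ∈ I k)
    {f : (Fin d → ℝ) → ℝ} {B : ℝ} (hB : ∀ y, |f y| ≤ B) {Λ : ℝ} (hΛ : 0 ≤ Λ)
    (hf : ∀ y z, |f y - f z| ≤ Λ * ‖y - z‖) :
    |∫ y, vertexSum g h x f y ∂(productLaw g) - f x| ≤ (3 ^ d - 1) * (Λ * h) := by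
  induction d with
  | zero =>
    have := hg.isProbabilityMeasure
    have h1 : ∀ y, vertexSum g h x f y = f x := fun y => by
      simpa [vertexSum] using congrArg f (Subsingleton.elim _ _)
    simp [h1]
  | succ d ih =>
    have hfm : Measurable f := (continuous_of_abs_sub_le hf).measurable
    have hcons : Measurable fun p : ℝ × (Fin d → ℝ) => (Fin.cons p.1 p.2 : Fin (d + 1) → ℝ) := by
      refine measurable_pi_iff.mpr fun k => ?_
      refine Fin.cases ?_ (fun k => ?_) k
      · simpa using measurable_fst
      · simpa using! (measurable_pi_apply k).comp measurable_snd
    have hfc : Measurable (Function.uncurry fun (s : ℝ) (z : Fin d → ℝ) => f (Fin.cons s z)) :=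
      hfm.comp hcons
    have hsec : ∀ s, Measurable fun z : Fin d → ℝ => f (Fin.cons s z) := fun s =>
      hfc.comp (measurable_const.prodMk measurable_id)
    set Φ : ℝ → ℝ := fun s => ∫ y, vertexSum (fun k => g k.succ) h (Fin.tail x)
      (fun z => f (Fin.cons s z)) y ∂(productLaw fun k => g k.succ) with hΦ
    have := hg.tail.isProbabilityMeasure
    have hΦm : Measurable Φ :=
      ((measurable_vertexSum hg.tail h (Fin.tail x) hfc).stronglyMeasurable.integral_prod_right'
        ).measurable
    have hΦf : ∀ s, |Φ s - f (Fin.cons s (Fin.tail x))| ≤ (3 ^ d - 1) * (Λ * h) := fun s => by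
      refine ih hg.tail (fun k => hx k.succ) (fun y => hB _) fun y z => (hf _ _).trans ?_
      refine mul_le_mul_of_nonneg_left ?_ hΛ
      refine (pi_norm_le_iff_of_nonneg (norm_nonneg _)).mpr fun k => ?_
      refine Fin.cases ?_ (fun k => ?_) k
      · simp
      · simpa using norm_le_pi_norm (y - z) k
    have hΦB : ∀ s, |Φ s| ≤ B + (3 ^ d - 1) * (Λ * h) := fun s => by
      have := abs_add_le (f (Fin.cons s (Fin.tail x))) (Φ s - f (Fin.cons s (Fin.tail x)))
      rw [add_sub_cancel] at this
      exact this.trans (add_le_add (hB _) (hΦf s))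
    have h1 : ∫ y, vertexSum g h x f y ∂(productLaw g)
        = ∫ s, ((1 - diffWeight (g 0) h (x 0) s) * Φ s
          + diffWeight (g 0) h (x 0) s * Φ (s + h)) ∂(densityLaw (g 0)) := by
      rw [integral_productLaw_succ hg (integrable_vertexSum hg hh x hfm hB)]
      congr 1
      funext s
      simp_rw [vertexSum_cons]
      rw [integral_add, integral_const_mul, integral_const_mul]
      · exact (integrable_vertexSum hg.tail hh _ (hsec s) fun y => hB _).const_mul _
      · exact (integrable_vertexSum hg.tail hh _ (hsec (s + h)) fun y => hB _).const_mul _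
    have h2 := (hg.density 0).abs_integral_diffWeight_sub_le (hg.isOpen 0) (hg.ordConnected 0)
      hg.pos (hg.le 0) (hx 0) hh hΦm hΦB (f := fun s => f (Fin.cons s (Fin.tail x))) hΛ
      (fun s t => (hf _ _).trans (mul_le_mul_of_nonneg_left
        ((pi_norm_le_iff_of_nonneg (abs_nonneg _)).mpr fun k => by
          refine Fin.cases ?_ (fun k => ?_) k <;> simp) hΛ)) hΦf
    rw [h1]
    simp only [Fin.cons_self_tail] at h2
    refine h2.trans (le_of_eq ?_)
    ring

/-! ### Moments of the uniform law on the cube -/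

/-- The uniform law on `(-ξ, ξ)`. -/
noncomputable def unif (ξ : ℝ) : Measure ℝ := ProbabilityTheory.cond volume (Set.Ioo (-ξ) ξ)

theorem isProbabilityMeasure_unif {ξ : ℝ} (hξ : 0 < ξ) : IsProbabilityMeasure (unif ξ) := by
  refine cond_isProbabilityMeasure_of_finite ?_ ?_
  · simpa using hξ
  · simp

theorem ae_abs_le_unif (ξ : ℝ) : ∀ᵐ v ∂(unif ξ), |v| ≤ ξ := by
  filter_upwards [ae_cond_mem (μ := volume) (s := Set.Ioo (-ξ) ξ) measurableSet_Ioo] with v hv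
  exact abs_le.mpr ⟨hv.1.le, hv.2.le⟩

theorem integral_pow_unif {ξ : ℝ} (hξ : 0 < ξ) (n : ℕ) :
    ∫ v, v ^ n ∂(unif ξ) = (2 * ξ)⁻¹ * ((ξ ^ (n + 1) - (-ξ) ^ (n + 1)) / (n + 1)) := by
  rw [unif, ProbabilityTheory.cond, integral_smul_measure, ← integral_Ioc_eq_integral_Ioo,
    ← intervalIntegral.integral_of_le (by linarith), integral_pow, Real.volume_Ioo, smul_eq_mul,
    ENNReal.toReal_inv, ENNReal.toReal_ofReal (by linarith)]
  congr 2
  ring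

theorem integral_pow_unif_of_odd {ξ : ℝ} (hξ : 0 < ξ) {n : ℕ} (hn : Odd n) :
    ∫ v, v ^ n ∂(unif ξ) = 0 := by
  rw [integral_pow_unif hξ, hn.add_one.neg_pow]
  simp

theorem sigmaSq_eq {ξ : ℝ} (hξ : 0 < ξ) : sigmaSq ξ = ξ ^ 2 / 3 := by
  have := integral_pow_unif hξ 2
  rw [unif] at this
  rw [sigmaSq, this]
  field_simp
  norm_num
  ring

/-- The law of a vector of independent variables uniform on `(-ξ, ξ)`. -/
noncomputable def cubeLaw (d : ℕ) (ξ : ℝ) : Measure (Fin d → ℝ) := Measure.pi fun _ => unif ξ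

theorem isProbabilityMeasure_cubeLaw (d : ℕ) {ξ : ℝ} (hξ : 0 < ξ) :
    IsProbabilityMeasure (cubeLaw d ξ) := by
  have := isProbabilityMeasure_unif hξ
  unfold cubeLaw
  infer_instance

theorem ae_abs_le_cubeLaw (d : ℕ) {ξ : ℝ} (hξ : 0 < ξ) :
    ∀ᵐ v ∂(cubeLaw d ξ), ∀ k, |v k| ≤ ξ := by
  have := isProbabilityMeasure_unif hξ
  rw [ae_all_iff]
  intro k
  exact (Measure.tendsto_eval_ae_ae (μ := fun _ : Fin d => unif ξ) (i := k)).eventually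
    (ae_abs_le_unif ξ)

theorem integrable_cubeLaw {d : ℕ} {ξ : ℝ} (hξ : 0 < ξ) {F : (Fin d → ℝ) → ℝ}
    (hF : Continuous F) : Integrable F (cubeLaw d ξ) := by
  have := isProbabilityMeasure_cubeLaw d hξ
  obtain ⟨B, hB⟩ := (isCompact_univ_pi fun _ : Fin d => isCompact_Icc (a := -ξ) (b := ξ)
    ).exists_bound_of_continuousOn hF.continuousOn
  refine Integrable.of_bound hF.aestronglyMeasurable B ?_
  filter_upwards [ae_abs_le_cubeLaw d hξ] with v hv
  exact hB v fun k _ => ⟨(abs_le.mp (hv k)).1, (abs_le.mp (hv k)).2⟩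

/-- By independence the integral factors. Unless `i` is the square-free index of `w`, some direction
of `w` has exponent `0 + 1`, and an odd moment of a symmetric law is zero. -/
theorem integral_monomial_cubeLaw {d : ℕ} {ξ : ℝ} (hξ : 0 < ξ) (w : Finset (Fin d))
    (i : Fin d → ℕ) (hi : ∑ k, i k = w.card) :
    ∫ v, (∏ k, v k ^ i k) * ∏ k ∈ w, v k ∂(cubeLaw d ξ)
      = if i = crossIndex w then sigmaSq ξ ^ w.card else 0 := by
  have := isProbabilityMeasure_unif hξ
  have h1 : ∀ v : Fin d → ℝ, (∏ k, v k ^ i k) * ∏ k ∈ w, v k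
      = ∏ k, v k ^ (i k + crossIndex w k) := fun v => by
    have : ∏ k ∈ w, v k = ∏ k, v k ^ crossIndex w k := by
      simp [crossIndex, Finset.prod_ite_mem, pow_ite]
    rw [this, ← Finset.prod_mul_distrib]
    simp_rw [pow_add]
  simp_rw [h1]
  rw [cubeLaw, integral_fintype_prod_eq_prod (f := fun k (t : ℝ) => t ^ (i k + crossIndex w k))]
  split_ifs with hw
  · subst hw
    have h2 : ∀ k, ∫ t, t ^ (crossIndex w k + crossIndex w k) ∂(unif ξ)
        = if k ∈ w then sigmaSq ξ else 1 := by
      intro k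
      by_cases hk : k ∈ w
      · simp [crossIndex, hk, sigmaSq, unif]
      · simp [crossIndex, hk]
    simp [h2]
  · have : ∃ k, Odd (i k + crossIndex w k) := by
      by_contra! hcon
      refine hw (eq_crossIndex_of_le (fun k hk => ?_) hi.le)
      have := hcon k
      rw [crossIndex, if_pos hk] at this
      rcases Nat.eq_zero_or_pos (i k) with h0 | h0
      · simp [h0] at this
      · exact h0
    obtain ⟨k, hk⟩ := this
    exact Finset.prod_eq_zero (Finset.mem_univ k) (integral_pow_unif_of_odd hξ hk)

theorem integral_homogeneous_cubeLaw {d : ℕ} {ξ : ℝ} (hξ : 0 < ξ) (w : Finset (Fin d))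
    (a : (Fin d → ℕ) → ℝ) (h : ℝ) :
    ∫ v, (∑ i ∈ Finset.piAntidiag (Finset.univ : Finset (Fin d)) w.card,
        a i * ∏ k, (h • v) k ^ i k) * ∏ k ∈ w, v k ∂(cubeLaw d ξ)
      = a (crossIndex w) * h ^ w.card * sigmaSq ξ ^ w.card := by
  have h1 : ∀ v : Fin d → ℝ, (∑ i ∈ Finset.piAntidiag (Finset.univ : Finset (Fin d)) w.card,
        a i * ∏ k, (h • v) k ^ i k) * ∏ k ∈ w, v k
      = ∑ i ∈ Finset.piAntidiag (Finset.univ : Finset (Fin d)) w.card,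
        (a i * h ^ w.card) * ((∏ k, v k ^ i k) * ∏ k ∈ w, v k) := fun v => by
    rw [Finset.sum_mul]
    refine Finset.sum_congr rfl fun i hi => ?_
    have hs : ∑ k, i k = w.card := (Finset.mem_piAntidiag.mp hi).1
    simp only [Pi.smul_apply, smul_eq_mul, mul_pow, Finset.prod_mul_distrib]
    rw [Finset.prod_pow_eq_pow_sum, hs]
    ring
  simp_rw [h1]
  rw [integral_finsetSum _ fun i _ => (integrable_cubeLaw hξ (by fun_prop)).const_mul _]
  have h2 : ∀ i ∈ Finset.piAntidiag (Finset.univ : Finset (Fin d)) w.card,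
      ∫ v, (a i * h ^ w.card) * ((∏ k, v k ^ i k) * ∏ k ∈ w, v k) ∂(cubeLaw d ξ)
      = if i = crossIndex w then a (crossIndex w) * h ^ w.card * sigmaSq ξ ^ w.card else 0 := by
    intro i hi
    rw [integral_const_mul, integral_monomial_cubeLaw hξ w i (Finset.mem_piAntidiag.mp hi).1]
    split_ifs with hw
    · rw [hw]
    · simp
  rw [Finset.sum_congr rfl h2, Finset.sum_ite_eq', if_pos (crossIndex_mem w)]

theorem abs_prod_le_pow {d : ℕ} (w : Finset (Fin d)) {q : Fin d → ℝ} {b : ℝ}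
    (hq : ∀ k, |q k| ≤ b) : |∏ k ∈ w, q k| ≤ b ^ w.card := by
  rw [Finset.abs_prod]
  exact (Finset.prod_le_prod (fun k _ => abs_nonneg _) fun k _ => hq k).trans (by simp)

theorem enorm2_smul_le {d : ℕ} {h ξ : ℝ} (hh : 0 ≤ h) (hξ : 0 ≤ ξ) {v : Fin d → ℝ}
    (hv : ∀ k, |v k| ≤ ξ) : enorm2 (h • v) ≤ d * (h * ξ) :=
  enorm2_le (by positivity) fun k => by
    rw [Pi.smul_apply, smul_eq_mul, abs_mul, abs_of_nonneg hh]
    exact mul_le_mul_of_nonneg_left (hv k) hh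

theorem Gam_nonneg {L : ℕ} (β : Fin L → ℝ) (C : ℕ → Fin L → ℝ) (p r : ℕ) : 0 ≤ Gam β C p r :=
  Finset.sum_nonneg fun _ _ => abs_nonneg _

theorem CoeffConstraints.abs_integral_sub_le {d : ℕ} {β : Fin (d + 1) → ℝ}
    {C : ℕ → Fin (d + 1) → ℝ} (hC : CoeffConstraints d (d - 1) β C) {w : Finset (Fin d)}
    (hp : w.card ∈ Finset.Icc 1 d) {A : ℝ} (hA : 0 ≤ A) {M : (Fin d → ℝ) → ℝ}
    (hM : Continuous M) {y : Fin d → ℝ} {a : (Fin d → ℕ) → ℝ}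
    (ha : ∀ z, |M (y + z) - taylorSum (w.card + 1) a z| ≤ A * enorm2 z ^ (w.card + 1))
    {h ξ : ℝ} (hh : 0 < h) (hξ : 0 < ξ) :
    |∫ v, (∑ l, C w.card l * M (y + β l • (h • v))) * ∏ k ∈ w, v k ∂(cubeLaw d ξ)
      - a (crossIndex w) * h ^ w.card * sigmaSq ξ ^ w.card|
      ≤ A * Gam β C w.card (w.card + 1) * (d * (h * ξ)) ^ (w.card + 1) * ξ ^ w.card := by
  have := isProbabilityMeasure_cubeLaw d hξ
  have hG := Gam_nonneg β C w.card (w.card + 1)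
  rw [← integral_homogeneous_cubeLaw hξ w a h, ← integral_sub
    (integrable_cubeLaw hξ (by fun_prop)) (integrable_cubeLaw hξ (by fun_prop))]
  suffices hle : ∀ᵐ v ∂(cubeLaw d ξ), ‖(∑ l, C w.card l * M (y + β l • (h • v))) * ∏ k ∈ w, v k
      - (∑ i ∈ Finset.piAntidiag (Finset.univ : Finset (Fin d)) w.card,
        a i * ∏ k, (h • v) k ^ i k) * ∏ k ∈ w, v k‖
      ≤ A * Gam β C w.card (w.card + 1) * (d * (h * ξ)) ^ (w.card + 1) * ξ ^ w.card by
    simpa using norm_integral_le_of_norm_le_const hle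
  filter_upwards [ae_abs_le_cubeLaw d hξ] with v hv
  rw [← sub_mul, norm_mul, Real.norm_eq_abs, Real.norm_eq_abs]
  refine mul_le_mul ((hC.abs_sum_sub_le hp ha (h • v)).trans ?_) (abs_prod_le_pow w hv)
    (abs_nonneg _) (by positivity)
  exact mul_le_mul_of_nonneg_left (pow_le_pow_left₀ (enorm2_nonneg _)
    (enorm2_smul_le hh.le hξ.le hv) _) (by positivity)

/-! ### Uniform bound and bias of one summand -/

theorem weightR_eq {d : ℕ} (g : Fin d → ℝ → ℝ) (h s2 : ℝ) (x y v : Fin d → ℝ) (k : Fin d) :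
    weightR g (fun _ => h) s2 x y v k = diffWeight (g k) h (x k) (y k) / s2 * v k := by
  rw [weightR, diffWeight, div_div]

/-- The contribution of one pair of sample points to the emulator at `x`. -/
noncomputable def summand {d L : ℕ} (M : (Fin d → ℝ) → ℝ) (g : Fin d → ℝ → ℝ) (h s2 : ℝ)
    (β : Fin L → ℝ) (C : ℕ → Fin L → ℝ) (x y v : Fin d → ℝ) : ℝ :=
  ∑ l, ∑ p ∈ Finset.Icc 1 d,
    C p l * M (fun k => y k + β l * h * v k) * esp p (weightR g (fun _ => h) s2 x y v)

theorem summand_eq {d L : ℕ} (M : (Fin d → ℝ) → ℝ) (g : Fin d → ℝ → ℝ) (h s2 : ℝ)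
    (β : Fin L → ℝ) (C : ℕ → Fin L → ℝ) (x y v : Fin d → ℝ) :
    summand M g h s2 β C x y v = ∑ p ∈ Finset.Icc 1 d,
      ∑ w ∈ Finset.powersetCard p (Finset.univ : Finset (Fin d)),
        (∑ l, C p l * M (y + β l • (h • v)))
          * ∏ k ∈ w, (diffWeight (g k) h (x k) (y k) / s2 * v k) := by
  rw [summand, Finset.sum_comm]
  refine Finset.sum_congr rfl fun p _ => ?_
  simp only [esp, weightR_eq]
  rw [← Finset.mul_sum, Finset.sum_mul]
  refine Finset.sum_congr rfl fun l _ => ?_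
  congr 3
  funext k
  simp [mul_assoc]

/-- A uniform bound for the contribution of one pair of sample points. -/
noncomputable def summandBound (d : ℕ) {L : ℕ} (A : ℕ → ℝ) (β : Fin L → ℝ) (C : ℕ → Fin L → ℝ)
    (ρ : ℝ) : ℝ :=
  ∑ p ∈ Finset.Icc 1 d, ∑ _w ∈ Finset.powersetCard p (Finset.univ : Finset (Fin d)),
    A p * Gam β C p p * (3 * d / ρ) ^ p

/-- The factor `(d h ξ) ^ p` from the coefficients meets `(3 / (ρ h ξ)) ^ p` from the weights, since
`σ² = ξ ^ 2 / 3`; both `h` and `ξ` cancel. -/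
theorem abs_summand_le {d : ℕ} {β : Fin (d + 1) → ℝ} {C : ℕ → Fin (d + 1) → ℝ}
    (hC : CoeffConstraints d (d - 1) β C) {A : ℕ → ℝ} (hA : ∀ α ≤ d + 1, 0 < A α)
    {g : Fin d → ℝ → ℝ} {I : Fin d → Set ℝ} {ρ : ℝ} (hg : IsLowerBounded g I ρ)
    {M : (Fin d → ℝ) → ℝ} (hM : ∀ α ≤ d + 1, InHolder α (A α) M) {h ξ : ℝ} (hh : 0 < h)
    (hξ : 0 < ξ) (x : Fin d → ℝ) {y v : Fin d → ℝ} (hy : ∀ k, y k ∈ I k)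
    (hv : ∀ k, |v k| ≤ ξ) :
    |summand M g h (sigmaSq ξ) β C x y v| ≤ summandBound d A β C ρ := by
  have hρ := hg.pos
  rw [summand_eq, summandBound]
  refine (Finset.abs_sum_le_sum_abs _ _).trans (Finset.sum_le_sum fun p hp => ?_)
  refine (Finset.abs_sum_le_sum_abs _ _).trans (Finset.sum_le_sum fun w hw => ?_)
  have hpd : p ≤ d + 1 := by have := (Finset.mem_Icc.mp hp).2; omega
  have hwp : w.card = p := (Finset.mem_powersetCard.mp hw).2
  have hAp := hA p hpd
  have hG := Gam_nonneg β C p p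
  have h1 : |∑ l, C p l * M (y + β l • (h • v))|
      ≤ A p * Gam β C p p * (d * (h * ξ)) ^ p :=
    (hC.abs_sum_le hp (hM p hpd) y (h • v)).trans (mul_le_mul_of_nonneg_left
      (pow_le_pow_left₀ (enorm2_nonneg _) (enorm2_smul_le hh.le hξ.le hv) _) (by positivity))
  have h2 : |∏ k ∈ w, (diffWeight (g k) h (x k) (y k) / sigmaSq ξ * v k)|
      ≤ (1 / (ρ * h) / (ξ ^ 2 / 3) * ξ) ^ p := by
    rw [← hwp]
    refine abs_prod_le_pow w fun k => ?_
    rw [sigmaSq_eq hξ, abs_mul, abs_div, abs_of_pos (show 0 < ξ ^ 2 / 3 by positivity)]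
    have h3 := abs_diffWeight_le (x := x k) hρ hh (hg.le k _ (hy k))
    exact mul_le_mul (by gcongr) (hv k) (abs_nonneg _) (by positivity)
  rw [abs_mul]
  refine (mul_le_mul h1 h2 (abs_nonneg _) (by positivity)).trans (le_of_eq ?_)
  rw [mul_assoc, ← mul_pow]
  congr 2
  field_simp

theorem measurable_summand {d L : ℕ} {M : (Fin d → ℝ) → ℝ} (hM : Continuous M)
    {g : Fin d → ℝ → ℝ} {I : Fin d → Set ℝ} {ρ : ℝ} (hg : IsLowerBounded g I ρ) (h s2 : ℝ)
    (β : Fin L → ℝ) (C : ℕ → Fin L → ℝ) (x : Fin d → ℝ) :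
    Measurable fun q : (Fin d → ℝ) × (Fin d → ℝ) => summand M g h s2 β C x q.1 q.2 := by
  simp only [summand_eq]
  refine Finset.measurable_sum _ fun p _ => Finset.measurable_sum _ fun w _ =>
    Measurable.mul ?_ (Finset.measurable_prod _ fun k _ => ?_)
  · exact Continuous.measurable (by fun_prop)
  · have h1 : Measurable fun q : (Fin d → ℝ) × (Fin d → ℝ) =>
        diffWeight (g k) h (x k) (q.1 k) :=
      ((hg.density k).measurable_diffWeight h (x k)).comp
        ((measurable_pi_apply k).comp measurable_fst)
    exact (h1.div_const _).mul ((measurable_pi_apply k).comp measurable_snd)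

/-- The constant in the bias that is due to the directions in a set of cardinality `p`. -/
noncomputable def biasConst (d : ℕ) {L : ℕ} (A : ℕ → ℝ) (β : Fin L → ℝ) (C : ℕ → Fin L → ℝ)
    (ρ ξ : ℝ) (p : ℕ) : ℝ :=
  A (p + 1) * Gam β C p (p + 1) * d ^ (p + 1) * (3 / ρ) ^ p * ξ
    + 2 ^ d * A (p + 1) * d ^ (p + 1) * (1 / ρ) ^ p

/-- Both quantities approximate the same Taylor coefficient times `h ^ |w|` with error `O(h ^ (|w| +
1))`, and the weights cost `(ρ h) ^ (-|w|)`. -/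
theorem abs_integral_mul_prod_sub_le {d : ℕ} {β : Fin (d + 1) → ℝ} {C : ℕ → Fin (d + 1) → ℝ}
    (hC : CoeffConstraints d (d - 1) β C) {g : Fin d → ℝ → ℝ} {I : Fin d → Set ℝ} {ρ : ℝ}
    (hg : IsLowerBounded g I ρ) {w : Finset (Fin d)} (hp : w.card ∈ Finset.Icc 1 d)
    {A : ℕ → ℝ} (hA : 0 ≤ A (w.card + 1)) {M : (Fin d → ℝ) → ℝ} (hMc : Continuous M)
    (hM : InHolder (w.card + 1) (A (w.card + 1)) M) {h ξ : ℝ} (hh : 0 < h) (hξ : 0 < ξ)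
    (x : Fin d → ℝ) {y : Fin d → ℝ} (hy : ∀ k, y k ∈ I k) :
    |∫ v, (∑ l, C w.card l * M (y + β l • (h • v)))
        * ∏ k ∈ w, (diffWeight (g k) h (x k) (y k) / sigmaSq ξ * v k) ∂(cubeLaw d ξ)
      - (∏ k ∈ w, diffWeight (g k) h (x k) (y k)) * forwardDiff w h M y|
      ≤ biasConst d A β C ρ ξ w.card * h := by
  have hρ := hg.pos
  obtain ⟨a, ha⟩ := hM.exists_taylor y
  have hs : 0 < sigmaSq ξ := by rw [sigmaSq_eq hξ]; positivity
  have h1 := hC.abs_integral_sub_le hp hA hMc ha hh hξ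
  have h2 := abs_forwardDiff_sub_le w hh.le hA ha
  have h3 : |∏ k ∈ w, diffWeight (g k) h (x k) (y k)| ≤ (1 / (ρ * h)) ^ w.card :=
    abs_prod_le_pow w fun k => abs_diffWeight_le hρ hh (hg.le k _ (hy k))
  have h4 : ∀ v : Fin d → ℝ, (∑ l, C w.card l * M (y + β l • (h • v)))
        * ∏ k ∈ w, (diffWeight (g k) h (x k) (y k) / sigmaSq ξ * v k)
      = (∏ k ∈ w, diffWeight (g k) h (x k) (y k)) / sigmaSq ξ ^ w.card
        * ((∑ l, C w.card l * M (y + β l • (h • v))) * ∏ k ∈ w, v k) := fun v => by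
    rw [Finset.prod_mul_distrib, Finset.prod_div_distrib, Finset.prod_const]
    ring
  simp_rw [h4]
  rw [integral_const_mul]
  set J := ∫ v, (∑ l, C w.card l * M (y + β l • (h • v))) * ∏ k ∈ w, v k ∂(cubeLaw d ξ)
  set q := ∏ k ∈ w, diffWeight (g k) h (x k) (y k)
  set F := forwardDiff w h M y
  -- Inserting the common Taylor term separates the moment error from the forward difference error.
  have h5 : q / sigmaSq ξ ^ w.card * J - q * F
      = q * ((J - a (crossIndex w) * h ^ w.card * sigmaSq ξ ^ w.card) / sigmaSq ξ ^ w.card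
        - (F - a (crossIndex w) * h ^ w.card)) := by
    field_simp
    ring
  rw [h5, abs_mul]
  have h6 : |(J - a (crossIndex w) * h ^ w.card * sigmaSq ξ ^ w.card) / sigmaSq ξ ^ w.card
      - (F - a (crossIndex w) * h ^ w.card)|
      ≤ A (w.card + 1) * Gam β C w.card (w.card + 1) * (d * (h * ξ)) ^ (w.card + 1)
          * ξ ^ w.card / sigmaSq ξ ^ w.card
        + 2 ^ d * (A (w.card + 1) * (d * h) ^ (w.card + 1)) := by
    refine (abs_sub _ _).trans (add_le_add ?_ h2)
    rw [abs_div, abs_of_pos (pow_pos hs _)]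
    gcongr
  refine (mul_le_mul h3 h6 (abs_nonneg _) (by positivity)).trans (le_of_eq ?_)
  rw [sigmaSq_eq hξ, biasConst]
  generalize w.card = p
  simp only [mul_pow, div_pow, pow_succ, one_div, inv_pow]
  field_simp
  ring

theorem sum_powersetCard_add {d : ℕ} (F : Finset (Fin d) → ℝ) :
    ∑ w, F w = F ∅ + ∑ p ∈ Finset.Icc 1 d,
      ∑ w ∈ Finset.powersetCard p (Finset.univ : Finset (Fin d)), F w := by
  rw [← Finset.powerset_univ, Finset.sum_powerset, Finset.card_univ, Fintype.card_fin,
    Finset.sum_range_succ']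
  rw [add_comm]
  congr 1
  · simp
  · exact Finset.sum_nbij' (· + 1) (· - 1) (fun p hp => by simp at hp ⊢; omega)
      (fun p hp => by simp at hp ⊢; omega) (fun p hp => by simp)
      (fun p hp => by simp at hp ⊢; omega) (fun _ _ => rfl)

/-- The constant in the bias of the emulator. -/
noncomputable def totalBiasConst (d : ℕ) {L : ℕ} (A : ℕ → ℝ) (β : Fin L → ℝ) (C : ℕ → Fin L → ℝ)
    (ρ ξ : ℝ) : ℝ :=
  (∑ p ∈ Finset.Icc 1 d, ∑ _w ∈ Finset.powersetCard p (Finset.univ : Finset (Fin d)),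
    biasConst d A β C ρ ξ p) + (3 ^ d - 1) * (A 1 * d)

theorem abs_integral_summand_sub_le {d : ℕ} {β : Fin (d + 1) → ℝ} {C : ℕ → Fin (d + 1) → ℝ}
    (hC : CoeffConstraints d (d - 1) β C) {A : ℕ → ℝ} (hA : ∀ α ≤ d + 1, 0 < A α)
    {g : Fin d → ℝ → ℝ} {I : Fin d → Set ℝ} {ρ : ℝ} (hg : IsLowerBounded g I ρ)
    {M : (Fin d → ℝ) → ℝ} (hMc : Continuous M) (hM : ∀ α ≤ d + 1, InHolder α (A α) M)
    {h ξ : ℝ} (hh : 0 < h) (hξ : 0 < ξ) (x : Fin d → ℝ) {y : Fin d → ℝ}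
    (hy : ∀ k, y k ∈ I k) :
    |∫ v, summand M g h (sigmaSq ξ) β C x y v ∂(cubeLaw d ξ) - (vertexSum g h x M y - M y)|
      ≤ ∑ p ∈ Finset.Icc 1 d, ∑ _w ∈ Finset.powersetCard p (Finset.univ : Finset (Fin d)),
        biasConst d A β C ρ ξ p * h := by
  have h1 : vertexSum g h x M y - M y = ∑ p ∈ Finset.Icc 1 d,
      ∑ w ∈ Finset.powersetCard p (Finset.univ : Finset (Fin d)),
        (∏ k ∈ w, diffWeight (g k) h (x k) (y k)) * forwardDiff w h M y := by
    rw [vertexSum, ← sum_prod_mul_forwardDiff (fun k => diffWeight (g k) h (x k) (y k)),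
      sum_powersetCard_add]
    -- With all weights zero, the expansion reduces to the empty set on one side and to the base
    -- vertex on the other, which identifies the term of `∅`.
    have h2 := sum_prod_mul_forwardDiff (fun _ : Fin d => (0 : ℝ)) h M y
    have h3 : forwardDiff ∅ h M y = M y := by
      rw [Finset.sum_eq_single ∅ (fun w _ hw => ?_) (by simp),
        Finset.sum_eq_single (fun _ => false) (fun u _ hu => ?_) (by simp)] at h2
      · have h4 : y + vertex h (fun _ => false) = y := by funext k; simp [vertex]
        simpa [h4] using h2
      · obtain ⟨k, hk⟩ := Function.ne_iff.mp hu
        rw [Finset.prod_eq_zero (Finset.mem_univ k) (by simpa using hk), zero_mul]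
      · obtain ⟨k, hk⟩ := Finset.nonempty_iff_ne_empty.mpr hw
        rw [Finset.prod_eq_zero hk rfl, zero_mul]
    rw [Finset.prod_empty, h3]
    ring
  have hint : ∀ p w, Integrable (fun v : Fin d → ℝ => (∑ l, C p l * M (y + β l • (h • v)))
      * ∏ k ∈ w, (diffWeight (g k) h (x k) (y k) / sigmaSq ξ * v k)) (cubeLaw d ξ) :=
    fun p w => integrable_cubeLaw hξ (by fun_prop)
  simp_rw [summand_eq]
  rw [h1, integral_finsetSum _ fun p _ => integrable_finsetSum _ fun w _ => hint p w,
    ← Finset.sum_sub_distrib]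
  refine (Finset.abs_sum_le_sum_abs _ _).trans (Finset.sum_le_sum fun p hp => ?_)
  rw [integral_finsetSum _ fun w _ => hint p w, ← Finset.sum_sub_distrib]
  refine (Finset.abs_sum_le_sum_abs _ _).trans (Finset.sum_le_sum fun w hw => ?_)
  obtain rfl : w.card = p := (Finset.mem_powersetCard.mp hw).2
  have hpd : w.card + 1 ≤ d + 1 := by have := (Finset.mem_Icc.mp hp).2; omega
  exact abs_integral_mul_prod_sub_le hC hg hp (hA _ hpd).le hMc (hM _ hpd) hh hξ x hy

theorem integrable_summand {d : ℕ} {β : Fin (d + 1) → ℝ} {C : ℕ → Fin (d + 1) → ℝ}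
    (hC : CoeffConstraints d (d - 1) β C) {A : ℕ → ℝ} (hA : ∀ α ≤ d + 1, 0 < A α)
    {g : Fin d → ℝ → ℝ} {I : Fin d → Set ℝ} {ρ : ℝ} (hg : IsLowerBounded g I ρ)
    {M : (Fin d → ℝ) → ℝ} (hMc : Continuous M) (hM : ∀ α ≤ d + 1, InHolder α (A α) M)
    {h ξ : ℝ} (hh : 0 < h) (hξ : 0 < ξ) (x : Fin d → ℝ) :
    Integrable (fun q : (Fin d → ℝ) × (Fin d → ℝ) =>
      summand M g h (sigmaSq ξ) β C x q.1 q.2) ((productLaw g).prod (cubeLaw d ξ)) := by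
  have := hg.isProbabilityMeasure
  have := isProbabilityMeasure_cubeLaw d hξ
  refine integrable_of_abs_le (measurable_summand hMc hg h _ β C x).aestronglyMeasurable
    (B := summandBound d A β C ρ) ?_
  filter_upwards [Measure.quasiMeasurePreserving_fst.ae hg.ae_mem,
    Measure.quasiMeasurePreserving_snd.ae (ae_abs_le_cubeLaw d hξ)] with q h1 h2
  exact abs_summand_le hC hA hg hM hh hξ x h1 h2

/-- The bias of the emulator is of the order of the step `h`. -/
theorem abs_integral_summand_sub_centered_le {d : ℕ} {β : Fin (d + 1) → ℝ}
    {C : ℕ → Fin (d + 1) → ℝ} (hC : CoeffConstraints d (d - 1) β C) {A : ℕ → ℝ}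
    (hA : ∀ α ≤ d + 1, 0 < A α) {g : Fin d → ℝ → ℝ} {I : Fin d → Set ℝ} {ρ : ℝ}
    (hg : IsLowerBounded g I ρ) {M : (Fin d → ℝ) → ℝ} (hMc : Continuous M)
    (hM : ∀ α ≤ d + 1, InHolder α (A α) M) {h ξ : ℝ} (hh : 0 < h) (hξ : 0 < ξ)
    {x : Fin d → ℝ} (hx : ∀ k, x k ∈ I k) :
    |∫ q, summand M g h (sigmaSq ξ) β C x q.1 q.2 ∂((productLaw g).prod (cubeLaw d ξ))
      - centered M g x| ≤ totalBiasConst d A β C ρ ξ * h := by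
  have := hg.isProbabilityMeasure
  have := isProbabilityMeasure_cubeLaw d hξ
  have hint := integrable_summand hC hA hg hMc hM hh hξ x
  have hMB : ∀ y, |M y| ≤ A 0 := (hM 0 (by omega)).abs_le
  have hMi : Integrable M (productLaw g) :=
    integrable_of_abs_le hMc.aestronglyMeasurable (ae_of_all _ hMB)
  have hVi := integrable_vertexSum hg hh x hMc.measurable hMB
  have h1 : |∫ y, (∫ v, summand M g h (sigmaSq ξ) β C x y v ∂(cubeLaw d ξ)
      - (vertexSum g h x M y - M y)) ∂(productLaw g)|
      ≤ ∑ p ∈ Finset.Icc 1 d, ∑ _w ∈ Finset.powersetCard p (Finset.univ : Finset (Fin d)),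
        biasConst d A β C ρ ξ p * h := by
    have h2 : ∀ᵐ y ∂(productLaw g), ‖∫ v, summand M g h (sigmaSq ξ) β C x y v ∂(cubeLaw d ξ)
        - (vertexSum g h x M y - M y)‖ ≤ ∑ p ∈ Finset.Icc 1 d,
          ∑ _w ∈ Finset.powersetCard p (Finset.univ : Finset (Fin d)),
            biasConst d A β C ρ ξ p * h := by
      filter_upwards [hg.ae_mem] with y hy
      exact abs_integral_summand_sub_le hC hA hg hMc hM hh hξ x hy
    simpa using norm_integral_le_of_norm_le_const h2
  have hA1 := hA 1 (by omega)
  have h3 := abs_integral_vertexSum_sub_le hg hh hx hMB (Λ := A 1 * d) (by positivity)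
    ((hM 1 (by omega)).abs_sub_le_norm hA1.le)
  have h4 : Integrable (fun y => ∫ v, summand M g h (sigmaSq ξ) β C x y v ∂(cubeLaw d ξ))
      (productLaw g) := hint.integral_prod_left
  have hVMi : Integrable (fun y => vertexSum g h x M y - M y) (productLaw g) := hVi.sub hMi
  rw [integral_sub h4 hVMi, integral_sub hVi hMi] at h1
  rw [integral_prod _ hint, centered, totalBiasConst, add_mul]
  simp only [Finset.sum_mul]
  have h5 := abs_le.mp h1
  have h6 := abs_le.mp h3
  rw [abs_le]
  constructor <;> linarith

/-! ### Samples -/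

theorem indepFun_of_disjoint_range {Ω ι κ κ' : Type*} [MeasurableSpace Ω] {P : Measure Ω}
    [Fintype κ] [Fintype κ'] {F : ι → Ω → ℝ} (hF : iIndepFun F P) (hm : ∀ i, Measurable (F i))
    (a : κ → ι) (b : κ' → ι) (hab : ∀ i j, a i ≠ b j) :
    IndepFun (fun ω i => F (a i) ω) (fun ω j => F (b j) ω) P := by
  classical
  have hd : Disjoint (Finset.univ.image a) (Finset.univ.image b) := by
    rw [Finset.disjoint_left]
    intro i hi hi'
    obtain ⟨j, -, rfl⟩ := Finset.mem_image.mp hi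
    obtain ⟨j', -, h⟩ := Finset.mem_image.mp hi'
    exact hab j j' h.symm
  have h1 := hF.indepFun_finset _ _ hd hm
  exact h1.comp
    (φ := fun (q : Finset.univ.image a → ℝ) (i : κ) =>
      q ⟨a i, Finset.mem_image_of_mem a (Finset.mem_univ i)⟩)
    (ψ := fun (q : Finset.univ.image b → ℝ) (i : κ') =>
      q ⟨b i, Finset.mem_image_of_mem b (Finset.mem_univ i)⟩)
    (measurable_pi_iff.mpr fun i => measurable_pi_apply _)
    (measurable_pi_iff.mpr fun i => measurable_pi_apply _)

theorem IsSample.measurable_elim {S : Type*} [MeasurableSpace S] {P : Measure S} {d N : ℕ}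
    {g : Fin d → ℝ → ℝ} {ξ : ℝ} {X V : Fin N → Fin d → S → ℝ} (hS : IsSample P g ξ X V)
    (i : Fin N × Fin d ⊕ Fin N × Fin d) :
    Measurable (Sum.elim (fun a : Fin N × Fin d => X a.1 a.2)
      (fun a : Fin N × Fin d => V a.1 a.2) i) := by
  rcases i with i | i
  · exact hS.measurable_X _ _
  · exact hS.measurable_V _ _

theorem IsSample.map_eq {S : Type*} [MeasurableSpace S] {P : Measure S} [IsProbabilityMeasure P]
    {d N : ℕ} {g : Fin d → ℝ → ℝ} {ξ : ℝ} {X V : Fin N → Fin d → S → ℝ}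
    (hS : IsSample P g ξ X V) (i : Fin N) :
    P.map (fun ω => ((fun k => X i k ω, fun k => V i k ω) : (Fin d → ℝ) × (Fin d → ℝ)))
      = (productLaw g).prod (cubeLaw d ξ) := by
  have h1 := indepFun_of_disjoint_range hS.indep hS.measurable_elim
    (fun k : Fin d => Sum.inl (i, k)) (fun k : Fin d => Sum.inr (i, k)) (by simp)
  have hX : Measurable fun ω => fun k => X i k ω :=
    measurable_pi_iff.mpr fun k => hS.measurable_X i k
  have hV : Measurable fun ω => fun k => V i k ω :=
    measurable_pi_iff.mpr fun k => hS.measurable_V i k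
  have h2 := (indepFun_iff_map_prod_eq_prod_map_map hX.aemeasurable hV.aemeasurable).mp h1
  have h3 : iIndepFun (fun k => X i k) P :=
    hS.indep.precomp (g := fun k : Fin d => Sum.inl (i, k)) fun k k' h => by simpa using h
  have h4 : iIndepFun (fun k => V i k) P :=
    hS.indep.precomp (g := fun k : Fin d => Sum.inr (i, k)) fun k k' h => by simpa using h
  rw [h2, h3.map_fun_eq_pi_map fun k => (hS.measurable_X i k).aemeasurable,
    h4.map_fun_eq_pi_map fun k => (hS.measurable_V i k).aemeasurable]
  simp_rw [hS.law_X i]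
  have h5 : ∀ k, P.map (V i k) = unif ξ := hS.law_V i
  simp_rw [h5]
  rfl

/-- The variables of draws `i` and `j` form disjoint subfamilies of the independent family. Pairwise
independence is all that the variance computation needs. -/
theorem IsSample.indepFun_pair {S : Type*} [MeasurableSpace S] {P : Measure S} {d N : ℕ}
    {g : Fin d → ℝ → ℝ} {ξ : ℝ} {X V : Fin N → Fin d → S → ℝ} (hS : IsSample P g ξ X V)
    {i j : Fin N} (hij : i ≠ j) :
    IndepFun (fun ω => ((fun k => X i k ω, fun k => V i k ω) : (Fin d → ℝ) × (Fin d → ℝ)))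
      (fun ω => ((fun k => X j k ω, fun k => V j k ω) : (Fin d → ℝ) × (Fin d → ℝ))) P := by
  have h1 := indepFun_of_disjoint_range hS.indep hS.measurable_elim
    (Sum.map (fun k : Fin d => (i, k)) (fun k : Fin d => (i, k)))
    (Sum.map (fun k : Fin d => (j, k)) (fun k : Fin d => (j, k)))
    (by rintro (k | k) (k' | k') <;> simp [hij])
  have h2 : Measurable fun q : Fin d ⊕ Fin d → ℝ =>
      ((fun k => q (Sum.inl k), fun k => q (Sum.inr k)) : (Fin d → ℝ) × (Fin d → ℝ)) :=
    (measurable_pi_iff.mpr fun k => measurable_pi_apply _).prodMk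
      (measurable_pi_iff.mpr fun k => measurable_pi_apply _)
  exact h1.comp h2 h2

/-- The mean squared error of an average of bounded, pairwise independent variables. -/
theorem lintegral_sq_average_sub_le {S : Type*} [MeasurableSpace S] {P : Measure S}
    [IsProbabilityMeasure P] {N : ℕ} (hN : 1 ≤ N) {Y : Fin N → S → ℝ}
    (hY : ∀ i, Measurable (Y i)) {B : ℝ} (hB : ∀ i, ∀ᵐ ω ∂P, |Y i ω| ≤ B)
    (hi : Pairwise fun i j => IndepFun (Y i) (Y j) P) {m m' b : ℝ}
    (hm : ∀ i, ∫ ω, Y i ω ∂P = m') (hb : |m' - m| ≤ b) :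
    ∫⁻ ω, ENNReal.ofReal ((1 / (N : ℝ) * ∑ i, Y i ω - m) ^ 2) ∂P
      ≤ ENNReal.ofReal (B ^ 2 / N + b ^ 2) := by
  have hN0 : (0 : ℝ) < N := by exact_mod_cast hN
  have hL : ∀ i, MemLp (Y i) 2 P := fun i =>
    MemLp.of_bound (hY i).aestronglyMeasurable B (hB i)
  have hZ : MemLp (fun ω => 1 / (N : ℝ) * ∑ i, Y i ω) 2 P :=
    (memLp_finsetSum Finset.univ fun i _ => hL i).const_mul _
  have hW : MemLp (fun ω => 1 / (N : ℝ) * ∑ i, Y i ω - m) 2 P := hZ.sub (memLp_const m)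
  have hEW : ∫ ω, (1 / (N : ℝ) * ∑ i, Y i ω - m) ∂P = m' - m := by
    rw [integral_sub (hZ.integrable one_le_two) (integrable_const _), integral_const_mul,
      integral_finsetSum _ fun i _ => (hL i).integrable one_le_two]
    simp only [hm, Finset.sum_const, Finset.card_univ, Fintype.card_fin, nsmul_eq_mul,
      integral_const, probReal_univ, smul_eq_mul]
    field_simp
  have hvar : variance (fun ω => 1 / (N : ℝ) * ∑ i, Y i ω - m) P ≤ B ^ 2 / N := by
    rw [variance_sub_const hZ.aestronglyMeasurable, variance_const_mul]
    have h1 := IndepFun.variance_sum (s := Finset.univ) (fun i _ => hL i)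
      (fun i _ j _ hij => hi hij)
    have h2 : (fun ω => ∑ i, Y i ω) = ∑ i, Y i := by funext ω; simp
    rw [h2, h1]
    have h3 : ∀ i ∈ (Finset.univ : Finset (Fin N)), variance (Y i) P ≤ B ^ 2 := fun i _ => by
      have := variance_le_sq_of_bounded (a := -B) (b := B) (μ := P) (X := Y i)
        ((hB i).mono fun ω h => abs_le.mp h) (hY i).aemeasurable
      calc _ ≤ _ := this
        _ = B ^ 2 := by ring
    calc (1 / (N : ℝ)) ^ 2 * ∑ i, variance (Y i) P ≤ (1 / (N : ℝ)) ^ 2 * ∑ _i : Fin N, B ^ 2 :=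
          mul_le_mul_of_nonneg_left (Finset.sum_le_sum h3) (by positivity)
      _ = B ^ 2 / N := by
        rw [Finset.sum_const, Finset.card_univ, Fintype.card_fin, nsmul_eq_mul]
        field_simp
  rw [← ofReal_integral_eq_lintegral_ofReal hW.integrable_sq (ae_of_all _ fun _ => sq_nonneg _)]
  refine ENNReal.ofReal_le_ofReal ?_
  have h4 := variance_eq_sub hW
  rw [hEW] at h4
  -- The second moment is the variance plus the squared mean, and the mean of the error is the bias
  -- `m' - m`.
  have h5 : (m' - m) ^ 2 ≤ b ^ 2 := sq_le_sq.mpr (hb.trans (le_abs_self b))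
  have h6 : ∫ ω, ((fun ω => 1 / (N : ℝ) * ∑ i, Y i ω - m) ^ 2) ω ∂P
      = ∫ ω, (1 / (N : ℝ) * ∑ i, Y i ω - m) ^ 2 ∂P := rfl
  rw [h6] at h4
  linarith

theorem emulator_eq {d N L : ℕ} (M : (Fin d → ℝ) → ℝ) (g : Fin d → ℝ → ℝ) (h s2 : ℝ)
    (β : Fin L → ℝ) (C : ℕ → Fin L → ℝ) (X V : Fin N → Fin d → ℝ) (x : Fin d → ℝ) :
    emulator M g (fun _ => h) s2 β C X V x
      = 1 / (N : ℝ) * ∑ i, summand M g h s2 β C x (X i) (V i) := rfl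

theorem mse_le {S : Type*} [MeasurableSpace S] {P : Measure S} [IsProbabilityMeasure P]
    {d N : ℕ} (hN : 1 ≤ N) {β : Fin (d + 1) → ℝ} {C : ℕ → Fin (d + 1) → ℝ}
    (hC : CoeffConstraints d (d - 1) β C) {A : ℕ → ℝ} (hA : ∀ α ≤ d + 1, 0 < A α)
    {g : Fin d → ℝ → ℝ} {I : Fin d → Set ℝ} {ρ : ℝ} (hg : IsLowerBounded g I ρ)
    {M : (Fin d → ℝ) → ℝ} (hM : ∀ α ≤ d + 1, InHolder α (A α) M) {h ξ : ℝ} (hh : 0 < h)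
    (hξ : 0 < ξ) {X V : Fin N → Fin d → S → ℝ} (hS : IsSample P g ξ X V) {x : Fin d → ℝ}
    (hx : ∀ k, x k ∈ I k) :
    mse P M g (fun _ => h) ξ β C X V x
      ≤ ENNReal.ofReal (summandBound d A β C ρ ^ 2 / N
        + (totalBiasConst d A β C ρ ξ * h) ^ 2) := by
  have := hg.isProbabilityMeasure
  have := isProbabilityMeasure_cubeLaw d hξ
  have hMc : Continuous M := continuous_of_abs_sub_le
    ((hM 1 (by omega)).abs_sub_le_norm (hA 1 (by omega)).le)
  have hFm := measurable_summand hMc hg h (sigmaSq ξ) β C x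
  have hpm : ∀ i, Measurable fun ω =>
      ((fun k => X i k ω, fun k => V i k ω) : (Fin d → ℝ) × (Fin d → ℝ)) := fun i =>
    (measurable_pi_iff.mpr fun k => hS.measurable_X i k).prodMk
      (measurable_pi_iff.mpr fun k => hS.measurable_V i k)
  have hbd : ∀ i, ∀ᵐ ω ∂P, |summand M g h (sigmaSq ξ) β C x (fun k => X i k ω)
      (fun k => V i k ω)| ≤ summandBound d A β C ρ := fun i => by
    have h1 : ∀ᵐ q ∂((productLaw g).prod (cubeLaw d ξ)),
        |summand M g h (sigmaSq ξ) β C x q.1 q.2| ≤ summandBound d A β C ρ := by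
      filter_upwards [Measure.quasiMeasurePreserving_fst.ae hg.ae_mem,
        Measure.quasiMeasurePreserving_snd.ae (ae_abs_le_cubeLaw d hξ)] with q h1 h2
      exact abs_summand_le hC hA hg hM hh hξ x h1 h2
    rw [← hS.map_eq i] at h1
    exact ae_of_ae_map (hpm i).aemeasurable h1
  have hmean : ∀ i, ∫ ω, summand M g h (sigmaSq ξ) β C x (fun k => X i k ω)
      (fun k => V i k ω) ∂P = ∫ q, summand M g h (sigmaSq ξ) β C x q.1 q.2
        ∂((productLaw g).prod (cubeLaw d ξ)) := fun i => by
    rw [← hS.map_eq i, integral_map (hpm i).aemeasurable hFm.aestronglyMeasurable]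
  have hind : Pairwise fun i j => IndepFun
      (fun ω => summand M g h (sigmaSq ξ) β C x (fun k => X i k ω) (fun k => V i k ω))
      (fun ω => summand M g h (sigmaSq ξ) β C x (fun k => X j k ω) (fun k => V j k ω)) P :=
    fun i j hij => (hS.indepFun_pair hij).comp hFm hFm
  simp only [mse, emulator_eq]
  exact lintegral_sq_average_sub_le hN (fun i => hFm.comp (hpm i)) hbd hind hmean
    (abs_integral_summand_sub_centered_le hC hA hg hMc hM hh hξ hx)

/-! ### From one uniform estimate to the stated bounds -/

/-- The evaluation law is a probability carried by the sets `Ω k ⊆ I k`, so a bound uniform in `x`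
integrates to itself. -/
theorem errorsBoundedBy_of_forall_mse_le {S : Type*} [MeasurableSpace S] {P : Measure S}
    {d N L : ℕ} {Ω I : Fin d → Set ℝ} {M : (Fin d → ℝ) → ℝ} {f g : Fin d → ℝ → ℝ}
    {h : Fin d → ℝ} {ξ : ℝ} {β : Fin L → ℝ} {C : ℕ → Fin L → ℝ} {X V : Fin N → Fin d → S → ℝ}
    {T : ℝ} (hΩ : ∀ k, IsOpen (Ω k)) (hΩI : ∀ k, Ω k ⊆ I k)
    (hf : ∀ k, IsDensityOn (f k) (Ω k))
    (hT : ∀ x : Fin d → ℝ, (∀ k, x k ∈ I k) →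
      mse P M g h ξ β C X V x ≤ ENNReal.ofReal T) :
    ErrorsBoundedBy P I M f g h ξ β C X V T := by
  refine ⟨fun x hx => hT x fun k => hx k (Set.mem_univ k), ?_⟩
  have := fun k => (hf k).isProbabilityMeasure
  have hp : IsProbabilityMeasure (productLaw f) := by unfold productLaw; infer_instance
  calc imse P M f g h ξ β C X V ≤ ∫⁻ _x, ENNReal.ofReal T ∂(productLaw f) := by
        refine lintegral_mono_ae ?_
        filter_upwards [ae_mem_productLaw hf hΩ] with x hx
        exact hT x fun k => hΩI k (hx k)
    _ = ENNReal.ofReal T := by simp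

theorem ErrorsBoundedBy.mono {S : Type*} [MeasurableSpace S] {P : Measure S} {d N L : ℕ}
    {I : Fin d → Set ℝ} {M : (Fin d → ℝ) → ℝ} {f g : Fin d → ℝ → ℝ} {h : Fin d → ℝ} {ξ : ℝ}
    {β : Fin L → ℝ} {C : ℕ → Fin L → ℝ} {X V : Fin N → Fin d → S → ℝ} {T T' : ℝ}
    (hT : ErrorsBoundedBy P I M f g h ξ β C X V T) (hle : T ≤ T') :
    ErrorsBoundedBy P I M f g h ξ β C X V T' :=
  ⟨fun x hx => (hT.1 x hx).trans (ENNReal.ofReal_le_ofReal hle),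
    hT.2.trans (ENNReal.ofReal_le_ofReal hle)⟩

theorem biasConst_nonneg {d L : ℕ} {A : ℕ → ℝ} (β : Fin L → ℝ) (C : ℕ → Fin L → ℝ) {ρ ξ : ℝ}
    (hρ : 0 < ρ) (hξ : 0 ≤ ξ) {p : ℕ} (hA : 0 ≤ A (p + 1)) : 0 ≤ biasConst d A β C ρ ξ p := by
  have := Gam_nonneg β C p (p + 1)
  unfold biasConst
  positivity

theorem totalBiasConst_nonneg {d L : ℕ} {A : ℕ → ℝ} (hA : ∀ α ≤ d + 1, 0 < A α)
    (β : Fin L → ℝ) (C : ℕ → Fin L → ℝ) {ρ ξ : ℝ} (hρ : 0 < ρ) (hξ : 0 ≤ ξ) :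
    0 ≤ totalBiasConst d A β C ρ ξ := by
  have h3 : (0 : ℝ) ≤ 3 ^ d - 1 := sub_nonneg.mpr (one_le_pow₀ (by norm_num))
  refine add_nonneg (Finset.sum_nonneg fun p hp => Finset.sum_nonneg fun w _ =>
    biasConst_nonneg β C hρ hξ (hA _ ?_).le) (mul_nonneg h3 (mul_nonneg (hA 1 (by omega)).le
      (Nat.cast_nonneg d)))
  have := (Finset.mem_Icc.mp hp).2
  omega

/-- Replacing `ξ` by its largest admissible value makes the final constant independent of `ξ`. -/
theorem totalBiasConst_mono {d L : ℕ} {A : ℕ → ℝ} (hA : ∀ α ≤ d + 1, 0 < A α)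
    (β : Fin L → ℝ) (C : ℕ → Fin L → ℝ) {ρ ξ ξ' : ℝ} (hρ : 0 < ρ) (hle : ξ ≤ ξ') :
    totalBiasConst d A β C ρ ξ ≤ totalBiasConst d A β C ρ ξ' := by
  unfold totalBiasConst
  gcongr with p hp w hw
  have hpd := (Finset.mem_Icc.mp hp).2
  have := hA (p + 1) (by omega)
  have := Gam_nonneg β C p (p + 1)
  unfold biasConst
  gcongr

theorem sq_mul_rpow_neg_le {c η : ℝ} (hη : 1 / 2 < η) {N : ℕ} (hN : 1 ≤ N) :
    (c * (N : ℝ) ^ (-η)) ^ 2 ≤ c ^ 2 / N := by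
  have hN1 : (1 : ℝ) ≤ N := by exact_mod_cast hN
  have h1 : ((N : ℝ) ^ (-η)) ^ 2 ≤ (N : ℝ)⁻¹ := by
    rw [← Real.rpow_natCast, ← Real.rpow_mul (by positivity), ← Real.rpow_neg_one]
    refine Real.rpow_le_rpow_of_exponent_le hN1 ?_
    push_cast
    linarith
  rw [mul_pow, div_eq_mul_inv]
  gcongr

theorem minFactor_nonneg {d : ℕ} {c₀ : ℝ} (hc : 1 ≤ c₀) : 0 ≤ minFactor d c₀ := by
  have h1 : (0 : ℝ) ≤ (1 / (c₀ * d) + 1) ^ d - 1 :=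
    sub_nonneg.mpr (one_le_pow₀ (le_add_of_nonneg_left (by positivity)))
  unfold minFactor
  split_ifs
  · exact h1
  · exact le_min (one_div_nonneg.mpr (by linarith)) h1

/-- With `t = 1 / c₀ → 0`, this is the first-order expansion of `(1 + t / d) ^ d`, whose derivative
at 0 is 1. -/
theorem isEquivalent_pow_sub_one {d : ℕ} (hd : 1 ≤ d) :
    Asymptotics.IsEquivalent Filter.atTop
      (fun c₀ : ℝ => (1 / (c₀ * d) + 1) ^ d - 1) (fun c₀ : ℝ => 1 / c₀) := by
  have hd0 : (d : ℝ) ≠ 0 := by exact_mod_cast (by omega : d ≠ 0)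
  have h1 : HasDerivAt (fun t : ℝ => (t / d + 1) ^ d) 1 0 := by
    have h2 := (((hasDerivAt_id (0 : ℝ)).div_const (d : ℝ)).add_const 1).pow d
    refine h2.congr_deriv ?_
    simp [hd0]
  have h2 := (hasDerivAt_iff_isLittleO_nhds_zero.mp h1).comp_tendsto tendsto_inv_atTop_zero
  unfold Asymptotics.IsEquivalent
  refine (h2.congr ?_ ?_)
  · intro t
    simp [div_eq_mul_inv, mul_comm]
  · intro t
    simp

end Emulator

theorem mainTheorem6 (d : ℕ) (hd : 1 ≤ d)
    (β : Fin (d + 1) → ℝ) (hβ : Function.Injective β)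
    (C : ℕ → Fin (d + 1) → ℝ) (hC : Emulator.CoeffConstraints d (d - 1) β C)
    (A : ℕ → ℝ) (hA : ∀ α ≤ d + 1, 0 < A α)
    (ρmin : ℝ) (hρ : 0 < ρmin) (c : ℝ) (hc : 0 < c) :
    (∃ K : ℝ, 0 ≤ K ∧
      ∀ (Ω Ω' : Fin d → Set ℝ) (f g : Fin d → ℝ → ℝ) (M : (Fin d → ℝ) → ℝ) (ξ η : ℝ),
        (∀ k, IsOpen (Ω k)) →
        (∀ k, IsOpen (Ω' k) ∧ (Ω' k).OrdConnected) →
        (∀ k, Ω k ⊆ Ω' k) →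
        (∀ k, Emulator.IsDensityOn (f k) (Ω k)) →
        (∀ k, Emulator.IsDensityOn (g k) (Ω' k)) →
        Emulator.InSobolev (Set.univ.pi Ω) (Emulator.productLaw f) M →
        (∀ k, ∀ t ∈ Ω' k, ρmin ≤ g k t) →
        (∀ α ≤ d + 1, Emulator.InHolder α (A α) M) →
        0 < ξ →
        ξ ≤ (d * A (d + 1) * Emulator.Gam β C d (d + 1) * (1 / (2 * ρmin)) ^ d)⁻¹ →
        1 / 2 < η → η < 1 →
        ∀ (N : ℕ) (S : Type*) [MeasurableSpace S] (P : MeasureTheory.Measure S)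
          [MeasureTheory.IsProbabilityMeasure P] (X V : Fin N → Fin d → S → ℝ),
          ∀ h : Fin d → ℝ, 1 ≤ N → (∀ k, h k = c * (N : ℝ) ^ (-η)) →
          Emulator.IsSample P g ξ X V →
          Emulator.ErrorsBoundedBy P Ω' M f g h ξ β C X V
              (Emulator.digammaMax d hd A β C ^ 2 / N * (((d + 0.8) / (3 * ρmin ^ 2) + 1) ^ d - 1) + K / N) ∧
          (ρmin = Real.sqrt ((d + 0.8) / 3) →
            Emulator.ErrorsBoundedBy P Ω' M f g h ξ β C X V
              (Emulator.digammaMax d hd A β C ^ 2 / N * (2 ^ d - 1) + K / N)) ∧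
          (∀ c₀ : ℝ, 1 ≤ c₀ → c₀ ≤ 2 → ρmin = Real.sqrt (c₀ * d * (d + 0.8) / 3) →
            Emulator.ErrorsBoundedBy P Ω' M f g h ξ β C X V
              (Emulator.digammaMax d hd A β C ^ 2 / N * Emulator.minFactor d c₀ + K / N))) ∧
    Asymptotics.IsEquivalent Filter.atTop
      (fun c₀ : ℝ => (1 / (c₀ * d) + 1) ^ d - 1) (fun c₀ : ℝ => 1 / c₀) := by
  open Emulator in
  refine ⟨?_, isEquivalent_pow_sub_one hd⟩
  set ξ₀ : ℝ := (d * A (d + 1) * Gam β C d (d + 1) * (1 / (2 * ρmin)) ^ d)⁻¹ with hξ₀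
  have hG := Gam_nonneg β C d (d + 1)
  have hAd := hA (d + 1) le_rfl
  have hξ₀n : 0 ≤ ξ₀ := by positivity
  have hD := totalBiasConst_nonneg hA β C hρ hξ₀n
  -- The first square bounds the variance of one summand. The second bounds the squared bias at the
  -- largest admissible `ξ`, with the step replaced by `c`, the power of `N` being split off.
  set K : ℝ := summandBound d A β C ρmin ^ 2 + (totalBiasConst d A β C ρmin ξ₀ * c) ^ 2 with hK
  refine ⟨K, by positivity, ?_⟩
  intro Ω Ω' f g M ξ η hΩ hΩ' hΩΩ' hf hg _ hgρ hM hξ hξle hη _ N S _ P _ X V h hN hh hS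
  have hN0 : (0 : ℝ) < N := by exact_mod_cast hN
  obtain rfl : h = fun _ => c * (N : ℝ) ^ (-η) := funext hh
  have hgI : IsLowerBounded g Ω' ρmin :=
    ⟨hg, fun k => (hΩ' k).1, fun k => (hΩ' k).2, hρ, hgρ⟩
  have hstep : 0 < c * (N : ℝ) ^ (-η) := by positivity
  have hbound : summandBound d A β C ρmin ^ 2 / N
      + (totalBiasConst d A β C ρmin ξ * (c * (N : ℝ) ^ (-η))) ^ 2 ≤ K / N := by
    have h1 : (totalBiasConst d A β C ρmin ξ * (c * (N : ℝ) ^ (-η))) ^ 2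
        ≤ totalBiasConst d A β C ρmin ξ₀ ^ 2 * (c ^ 2 / N) := by
      rw [mul_pow]
      exact mul_le_mul (pow_le_pow_left₀ (totalBiasConst_nonneg hA β C hρ hξ.le)
        (totalBiasConst_mono hA β C hρ hξle) 2) (sq_mul_rpow_neg_le hη hN) (by positivity)
        (by positivity)
    refine (add_le_add_right h1 _).trans (le_of_eq ?_)
    rw [hK]
    ring
  -- The remainder alone already dominates the error, so any nonnegative factor `T` may stand in the
  -- leading term; the three claims differ only in the choice of `T`.
  have key : ∀ T : ℝ, 0 ≤ T → ErrorsBoundedBy P Ω' M f g (fun _ => c * (N : ℝ) ^ (-η)) ξ β C X V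
      (digammaMax d hd A β C ^ 2 / N * T + K / N) := by
    intro T hT
    refine errorsBoundedBy_of_forall_mse_le hΩ hΩΩ' hf fun x hx => ?_
    refine (mse_le hN hC hA hgI hM hstep hξ hS hx).trans (ENNReal.ofReal_le_ofReal ?_)
    exact hbound.trans (le_add_of_nonneg_left (by positivity))
  refine ⟨key _ ?_, fun _ => key _ ?_, fun c₀ hc₀ _ _ => key _ (minFactor_nonneg hc₀)⟩
  · exact sub_nonneg.mpr (one_le_pow₀ (le_add_of_nonneg_left (by positivity)))
  · exact sub_nonneg.mpr (one_le_pow₀ (by norm_num))
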